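/- **Setting.** Fix integers $N,F\ge 1$ and $t\in[N]$, and put $\mu=t/N$. A $\mu$-$(F,N)$ system consists of $N$ non-colluding servers and $F$ independent, uniformly random files $W_1,\dots,W_F$ of $L$ bits each, where every server $n$ stores, uncoded, exactly $\mu L$ of the bits of every file (its content is $Z_n$). In an (uncoded) PIR scheme a user who wants $W_\theta$ sends to each server $n$ a query $Q_n$, drawn with private randomness independent of the files, and the server returns a string $A_n$ of answer bits that is a deterministic function of $Q_n$ and $Z_n$, its length depending on $Q_n$ only. The scheme is *correct* if $W_\theta$ can be recovered with certainty from all queries and answers, for every $\theta$, and *private* if $I(\theta;Q_n,A_n,Z_n)=0$ for every server $n$ (and every distribution of $\theta$). Its *rate* is $L$ divided by the (expected) total number of downloaded bits. The *capacity* of the $\mu$-$(F,N)$ system is the supremum of the rates of all correct and private uncoded schemes for it, over all file sizes $L\ge 1$. A $(v,k,b,r)$-configuration is a family of $b$ non-empty blocks (repetitions allowed) on $v$ points such that every block contains $k$ points and every point lies in $r$ blocks. **The protocol.** Given a $(v,k,N,t)$-configuration and files of $L=v\cdot t^F$ bits, divide every file into $v$ subfiles of $t^F$ bits, and store the $j$-th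 subfile of every file on server $n$ if and only if the point $j$ lies in the block $n$. To retrieve $W_\theta$, retrieve, for each $j\in[v]$ and with independent randomness, the $j$-th subfile of $W_\theta$ from the $t$ servers that store the $j$-th subfiles, by the Sun–Jafar scheme for $t$ servers that store all of $F$ files of $t^F$ bits. (In the Sun–Jafar scheme each server is asked, for every non-empty set $T$ of files, for $(t-1)^{|T|-1}$ sums of one bit from each file of $T$; each sum of type $T\not\ni\theta$ downloaded from one server is added, at every other server, to a new bit of file $\theta$; all other bits requested are new; and the bits of each file are assigned by an independent uniformly random permutation.) **Theorem 2 (Capacity achieving PIR protocols).** For all integers $F\ge1$, $N\ge 1$ and $t\in[N]$, an $\big(\frac{N}{\gcd(N,t)},\frac{t}{\gcd(N,t)},N,t\big)$-configuration exists. For every such configuration the protocol above, with $v=\frac{N}{\gcd(N,t)}$ and file size $L=v\cdot t^F$, is a scheme for the $\mu$-$(F,N)$ system with $\mu=t/N$ in which the user only requests linear combinations of stored bits. It is correct and private, it always downloads exactly $v\sum_{f=0}^{F-1}t^{F-f}$ bits, and its rate equals the capacity of the $\mu$-$(F,N)$ system, which is $\big(1+\frac1t+\dots+\frac1{t^{F-1}}\big)^{-1}$.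 Its subpacketization satisfies $v=\frac{N}{\gcd(N,t)}\le N$. -/

import Mathlib

open scoped ENNReal BigOperators

noncomputable section

namespace PIR

/-! ### Tactical configurations -/

/-- A `(v, k, b, r)`-configuration: `v` points, a family of `b` non-empty blocks (repeated blocks
are allowed, as usual for designs given by an incidence matrix), every block has `k` points and
every point lies in `r` blocks. -/
structure TacticalConfiguration (v k b r : ℕ) where
  block : Fin b → Finset (Fin v)
  block_nonempty : ∀ n, (block n).Nonempty
  card_block : ∀ n, (block n).card = k
  card_repetition : ∀ j, (Finset.univ.filter fun n => j ∈ block n).card = r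

/-! ### Information theory -/

/-- The mutual information of the two components of a pair of discrete random variables with
joint law `p`: the relative entropy of `p` with respect to the product of its marginals. -/
def mutualInfo {α β : Type} (p : PMF (α × β)) : ℝ≥0∞ :=
  letI : MeasurableSpace (α × β) := ⊤
  InformationTheory.klDiv p.toMeasure
    ((p.map Prod.fst).bind fun a => (p.map Prod.snd).map fun b => (a, b)).toMeasure

/-- The law of `m` independent samples of `p`. -/
def iid {α : Type} (p : PMF α) : (m : ℕ) → PMF (Fin m → α)
  | 0 => PMF.pure Fin.elim0
  | m + 1 => p.bind fun a => (iid p m).map fun w => (Fin.cons a w : Fin (m + 1) → α)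

/-! ### Private information retrieval from uncoded storage -/

/-- `F` files of `L` bits each. -/
abbrev Files (F L : ℕ) : Type := Fin F → Fin L → ZMod 2

/-- What a server holds that stores, uncoded, the bits of the `i`-th file at the positions in
`s i`. -/
abbrev Content {F L : ℕ} (s : Fin F → Finset (Fin L)) : Type :=
  (i : Fin F) → {x : Fin L // x ∈ s i} → ZMod 2

/-- An uncoded PIR scheme for `N` servers and `F` files of `L` bits: which bits each server stores,
the law of the queries for every desired index (the randomness is private to the user and
independent of the files), and for every server and query a string of answer bits that is a
deterministic function of the query and of the content of that server. The number of answer bits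
depends on the query only. -/
structure Scheme (N F L : ℕ) where
  stored : Fin N → Fin F → Finset (Fin L)
  Query : Fin N → Type
  query : Fin F → PMF ((n : Fin N) → Query n)
  Ans : (n : Fin N) → Query n → Type
  ansFintype : ∀ n q, Fintype (Ans n q)
  answer : (n : Fin N) → (q : Query n) → Content (stored n) → (Ans n q → ZMod 2)

namespace Scheme

variable {N F L : ℕ} (S : Scheme N F L)

instance (n : Fin N) (q : S.Query n) : Fintype (S.Ans n q) := S.ansFintype n q

/-- The content `Z_n` of server `n`. -/
def content (n : Fin N) (W : Files F L) : Content (S.stored n) := fun i x => W i x.1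

/-- Every server stores the fraction `μ` of every file. -/
def HasStorage (μ : ℝ) : Prop := ∀ n i, ((S.stored n i).card : ℝ) = μ * L

/-- The user only requests linear combinations of bits stored on the servers. -/
def IsLinear : Prop := ∀ n q, IsLinearMap (ZMod 2) (S.answer n q)

/-- The desired file can be recovered, with certainty, from the queries and the answers. -/
def IsCorrect : Prop :=
  ∀ θ : Fin F, ∃ decode : ((n : Fin N) → Σ q : S.Query n, (S.Ans n q → ZMod 2)) → Fin L → ZMod 2,
    ∀ q ∈ (S.query θ).support, ∀ W : Files F L,
      decode (fun n => ⟨q n, S.answer n (q n) (S.content n W)⟩) = W θ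

/-- The joint law of the desired index (with law `p`) and of the query, the answer and the content
at server `n`. The files are uniform, and index, files and private randomness are independent. -/
def view (p : PMF (Fin F)) (n : Fin N) :
    PMF (Fin F × ((Σ q : S.Query n, (S.Ans n q → ZMod 2)) × Content (S.stored n))) :=
  p.bind fun θ => (PMF.uniformOfFintype (Files F L)).bind fun W => (S.query θ).map fun q =>
    (θ, (⟨q n, S.answer n (q n) (S.content n W)⟩, S.content n W))

/-- No single server learns anything about the desired index: `I(θ; Q_n, A_n, Z_n) = 0`. -/
def IsPrivate : Prop := ∀ (p : PMF (Fin F)) (n : Fin N), mutualInfo (S.view p n) = 0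

/-- The total number of bits downloaded when the queries are `q`. -/
def downloadedBits (q : (n : Fin N) → S.Query n) : ℕ := ∑ n, Fintype.card (S.Ans n (q n))

/-- The expected number of downloaded bits, for the worst desired index (for a private scheme it
does not depend on the index). -/
def downloadCost : ℝ≥0∞ := ⨆ θ : Fin F, ∑' q, S.query θ q * (S.downloadedBits q : ℝ≥0∞)

/-- The rate: file size divided by the number of downloaded bits. -/
def rate : ℝ≥0∞ := (L : ℝ≥0∞) / S.downloadCost

end Scheme

/-- The capacity of the `μ`-`(F, N)` system: the supremum of the rates of all uncoded schemes, for
any positive file size and any (not necessarily linear) answers, that store the fraction `μ` of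
every file on every server and are correct and private. -/
def capacity (μ : ℝ) (F N : ℕ) : ℝ≥0∞ :=
  sSup {R | ∃ L : ℕ, 0 < L ∧ ∃ S : Scheme N F L,
    S.HasStorage μ ∧ S.IsCorrect ∧ S.IsPrivate ∧ S.rate = R}

/-! ### The Sun-Jafar scheme for `t` servers that store all `F` files of `t ^ F` bits -/

/-- The slots of the query to one server: `(t - 1) ^ (#T - 1)` sums for every non-empty set `T` of
files, each of which is a sum of one bit of every file in `T`. -/
abbrev Slot (F t : ℕ) : Type :=
  Σ T : {T : Finset (Fin F) // T.Nonempty}, Fin ((t - 1) ^ (T.1.card - 1))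

/-- The labels under which the bits of file `i` are requested: a server and a slot of its query
whose set of files contains `i`. -/
abbrev Label (F t : ℕ) (i : Fin F) : Type := Fin t × {s : Slot F t // i ∈ s.1.1}

theorem card_label (F t : ℕ) (i : Fin F) :
    Fintype.card (Label F t i) = Fintype.card (Fin (t ^ F)) := by
  classical
  rcases t with _ | t
  · have hF : F ≠ 0 := fun h => by subst h; exact i.elim0
    simp [Label, hF]
  let e : {s : Slot F (t + 1) // i ∈ s.1.1} ≃
      Σ T : {T : Finset (Fin F) // i ∈ T}, Fin (t ^ (T.1.card - 1)) :=
    { toFun := fun s => ⟨⟨s.1.1.1, s.2⟩, s.1.2⟩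
      invFun := fun s => ⟨⟨⟨s.1.1, ⟨i, s.1.2⟩⟩, s.2⟩, s.1.2⟩
      left_inv := fun _ => rfl
      right_inv := fun _ => rfl }
  have h1 : Fintype.card {s : Slot F (t + 1) // i ∈ s.1.1} = (t + 1) ^ (F - 1) := by
    rw [Fintype.card_congr e, Fintype.card_sigma]
    simp only [Fintype.card_fin]
    have h2 := Finset.sum_pow_mul_eq_add_pow t 1 (Finset.univ.erase i)
    rw [Finset.card_erase_of_mem (Finset.mem_univ i), Finset.card_univ, Fintype.card_fin] at h2
    rw [← h2]
    refine Finset.sum_bij' (fun T _ => T.1.erase i)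
      (fun T _ => ⟨insert i T, Finset.mem_insert_self i T⟩) ?_ ?_ ?_ ?_ ?_
    · intro T _
      exact Finset.mem_powerset.2 (Finset.erase_subset_erase i (Finset.subset_univ _))
    · intro T _
      exact Finset.mem_univ _
    · intro T _
      exact Subtype.ext (Finset.insert_erase T.2)
    · intro T hT
      refine Finset.erase_insert fun h => ?_
      exact Finset.notMem_erase i _ (Finset.mem_powerset.1 hT h)
    · intro T _
      rw [Finset.card_erase_of_mem T.2, one_pow, mul_one]
  have hF : F - 1 + 1 = F := Nat.sub_add_cancel (Nat.succ_le_of_lt i.pos)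
  rw [Fintype.card_prod, h1, Fintype.card_fin, Fintype.card_fin, ← pow_succ', hF]

instance (F t : ℕ) (i : Fin F) : Nonempty (Label F t i ≃ Fin (t ^ F)) :=
  ⟨Fintype.equivOfCardEq (card_label F t i)⟩

/-- The servers other than `n`, numbered by `Fin (t - 1)` in cyclic order. -/
def otherServer {t : ℕ} (n : Fin t) (h : Fin (t - 1)) : Fin t :=
  ⟨(n + (h + 1)) % t, Nat.mod_lt _ n.pos⟩

theorem pow_erase {F t : ℕ} (T : Finset (Fin F)) (θ i : Fin F) (hθ : θ ∈ T) (hi : i ∈ T)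
    (hne : i ≠ θ) :
    (t - 1) ^ (T.card - 1) = (t - 1) * (t - 1) ^ ((T.erase θ).card - 1) := by
  have h1 := Finset.card_erase_of_mem hθ
  have h2 : 0 < (T.erase θ).card := Finset.card_pos.2 ⟨i, Finset.mem_erase.2 ⟨hne, hi⟩⟩
  rw [← pow_succ']
  congr 1
  omega

/-- The label of the bit of file `i` in slot `s` of the query to server `n` when file `θ` is
desired. The bits of the desired file, and all bits in the slots that do not involve the desired
file, are new. The other bits in a slot that involves the desired file and some other files form
an interference sum that is downloaded from one of the other servers: the sums of type `T` at
server `n` use every sum of type `T \ {θ}` at every other server exactly once. -/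
def sjLabel {F t : ℕ} (θ : Fin F) (n : Fin t) (s : Slot F t) (i : {i : Fin F // i ∈ s.1.1}) :
    Label F t i.1 :=
  if h : θ ∈ s.1.1 ∧ i.1 ≠ θ then
    let hi : i.1 ∈ s.1.1.erase θ := Finset.mem_erase.2 ⟨h.2, i.2⟩
    let a := finProdFinEquiv.symm (Fin.cast (pow_erase s.1.1 θ i.1 h.1 i.2 h.2) s.2)
    (otherServer n a.1, ⟨⟨⟨s.1.1.erase θ, ⟨i.1, hi⟩⟩, a.2⟩, hi⟩)
  else (n, ⟨s, i.2⟩)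

/-- The Sun-Jafar scheme: for every file an independent, uniformly random one-to-one assignment of
its bit positions to its labels is drawn, and every server is asked for the sums in all its
slots. -/
def sunJafar (F t : ℕ) : Scheme t F (t ^ F) where
  stored := fun _ _ => Finset.univ
  Query := fun _ => (s : Slot F t) → {i : Fin F // i ∈ s.1.1} → Fin (t ^ F)
  query := fun θ =>
    (PMF.uniformOfFintype ((i : Fin F) → (Label F t i ≃ Fin (t ^ F)))).map
      fun g n s i => g i.1 (sjLabel θ n s i)
  Ans := fun _ _ => Slot F t
  ansFintype := fun _ _ => inferInstance
  answer := fun _ q Z s => ∑ i : {i : Fin F // i ∈ s.1.1}, Z i.1 ⟨q s i, Finset.mem_univ _⟩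

/-! ### PIR protocols from tactical configurations -/

namespace TacticalConfiguration

variable {v k b r : ℕ} (C : TacticalConfiguration v k b r)

/-- The `r` servers that store the `j`-th subfiles, in increasing order. -/
def servers (j : Fin v) :
    Fin r ≃o {n : Fin b // n ∈ Finset.univ.filter fun n => j ∈ C.block n} :=
  Finset.orderIsoOfFin _ (C.card_repetition j)

/-- The number of server `n` among the servers that store the `j`-th subfiles. -/
def serverIndex {n : Fin b} (j : {j : Fin v // j ∈ C.block n}) : Fin r :=
  (C.servers j.1).symm ⟨n, Finset.mem_filter.2 ⟨Finset.mem_univ _, j.2⟩⟩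

/-- Every file of `v * M` bits is divided into `v` subfiles of `M` consecutive bits. -/
def subfile {M : ℕ} (x : Fin (v * M)) : Fin v := (finProdFinEquiv.symm x).1

/-- Server `n` stores the `j`-th subfile of every file exactly if point `j` lies in block `n`. -/
def placement (F M : ℕ) (n : Fin b) (_ : Fin F) : Finset (Fin (v * M)) :=
  Finset.univ.filter fun x => subfile x ∈ C.block n

theorem mem_placement {F M : ℕ} (n : Fin b) (i : Fin F) (j : {j : Fin v // j ∈ C.block n})
    (x : Fin M) : finProdFinEquiv (j.1, x) ∈ C.placement F M n i := by
  refine Finset.mem_filter.2 ⟨Finset.mem_univ _, ?_⟩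
  rw [subfile, Equiv.symm_apply_apply]
  exact j.2

/-- The protocol obtained from a configuration and a scheme `P` for `r` servers: each file is
divided into `v` subfiles, the subfiles are stored according to the configuration, and for every
`j` the `j`-th subfile of the desired file is retrieved by an independent run of `P` on the `r`
servers that store the `j`-th subfiles. -/
def lift {F M : ℕ} (P : Scheme r F M) : Scheme b F (v * M) where
  stored := C.placement F M
  Query := fun n => (j : {j : Fin v // j ∈ C.block n}) → P.Query (C.serverIndex j)
  query := fun θ => (iid (P.query θ) v).map fun q _ j => q j.1 (C.serverIndex j)
  Ans := fun _ q => Σ j, P.Ans (C.serverIndex j) (q j)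
  ansFintype := fun _ _ => inferInstance
  answer := fun n q Z a => P.answer (C.serverIndex a.1) (q a.1)
    (fun i x => Z i ⟨finProdFinEquiv (a.1.1, x.1), C.mem_placement n i a.1 x.1⟩) a.2

/-- The proposed protocol for `F` files of size `v * r ^ F`: storage by the configuration and
retrieval of every subfile by the Sun-Jafar scheme. -/
def protocol (F : ℕ) : Scheme b F (v * r ^ F) := C.lift (sunJafar F r)

end TacticalConfiguration

end PIR

end

/-! Achievability. Cyclic intervals, repeated `gcd N t` times, form a configuration. In the
Sun-Jafar scheme the interference in each sum with a desired bit is itself downloaded elsewhere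
(`exists_interference`), which gives correctness. Each server sees distinct labels of every file
under uniformly random assignments, so the law of its query does not depend on θ. Running
independent copies on the subfiles preserves all this.

Converse. Servers may store arbitrary and uneven sets of bits, so the bound is proved bit by bit.
Let a(θ, k, P) be the entropy of the answers for θ given the queries, the files of index below k and
the contents of the servers in P. The chain rule, subadditivity and privacy give
(`ambiguity_add_sum_le`) a(θ', k, P) + ∑_{n ∉ P} a(θ, k, P ∪ {n}) ≤ |Pᶜ| a(θ, k, P), and correctness
splits the bits of file θ missed by P off a(θ, θ, P). A double induction, over the remaining files
and over Pᶜ, yields a(θ, θ + 1, P) ≥ ∑ s_x^{-(i - θ)}, summed over the bits x of files i > θ missed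
by P, where s_x is the number of servers storing x (`missedWeight_le_ambiguity`). For θ = 0 and P =
∅ the download is at least ∑_i ∑_x s_x^{-i}. Within a file the average of s_x is t, so convexity
bounds this below by L ∑_i t^{-i}, the cost of the protocol when L is its file size. -/

namespace PIR

/-! ### Entropy of functions on a finite uniform probability space -/

section Entropy

variable {Ω : Type*} [Fintype Ω] {α β γ : Type*}

open Classical in
/-- The number of points at which `f` takes the value `f ω`. -/
noncomputable def fiberCard (f : Ω → α) (ω : Ω) : ℕ :=
  (Finset.univ.filter fun ω' => f ω' = f ω).card

/-- The Shannon entropy, in bits, of `f ω` for a uniformly random `ω`. -/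
noncomputable def entropy (f : Ω → α) : ℝ :=
  (∑ ω, (Real.log (Fintype.card Ω) - Real.log (fiberCard f ω))) / (Fintype.card Ω * Real.log 2)

theorem fiberCard_pos (f : Ω → α) (ω : Ω) : 0 < fiberCard f ω := by
  classical
  exact Finset.card_pos.2 ⟨ω, by simp⟩

theorem fiberCard_eq_of_eq (f : Ω → α) {ω ω' : Ω} (h : f ω = f ω') :
    fiberCard f ω = fiberCard f ω' := by
  rw [fiberCard, fiberCard, h]

theorem fiberCard_le_of_determines {f : Ω → α} {g : Ω → β}
    (h : ∀ ω ω', f ω = f ω' → g ω = g ω') (ω : Ω) : fiberCard f ω ≤ fiberCard g ω := by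
  classical
  refine Finset.card_le_card fun ω' hω' => ?_
  simp only [Finset.mem_filter, Finset.mem_univ, true_and] at hω' ⊢
  exact h _ _ hω'

theorem entropy_le_of_determines {f : Ω → α} {g : Ω → β}
    (h : ∀ ω ω', f ω = f ω' → g ω = g ω') : entropy g ≤ entropy f := by
  unfold entropy
  have h2 : (0 : ℝ) ≤ Real.log 2 := Real.log_nonneg one_le_two
  gcongr with ω
  · exact_mod_cast fiberCard_pos f ω
  · exact fiberCard_le_of_determines h ω

theorem entropy_congr {f : Ω → α} {g : Ω → β} (h : ∀ ω ω', f ω = f ω' ↔ g ω = g ω') :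
    entropy f = entropy g :=
  le_antisymm (entropy_le_of_determines fun ω ω' => (h ω ω').2)
    (entropy_le_of_determines fun ω ω' => (h ω ω').1)

-- A fibre of c points carries c weights 1/c; the sum is 1, or 0 when `a` is not attained.
open Classical in
theorem sum_inv_fiberCard_le_one (f : Ω → α) (a : α) :
    ∑ ω, (if f ω = a then ((fiberCard f ω : ℝ))⁻¹ else 0) ≤ 1 := by
  rw [← Finset.sum_filter]
  have h : ∀ ω ∈ Finset.univ.filter (fun ω => f ω = a), ((fiberCard f ω : ℝ))⁻¹ =
      (((Finset.univ.filter fun ω => f ω = a).card : ℝ))⁻¹ := by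
    intro ω hω
    rw [Finset.mem_filter] at hω
    rw [fiberCard, hω.2]
  rw [Finset.sum_congr rfl h, Finset.sum_const, nsmul_eq_mul]
  exact mul_inv_le_one

open Classical in
theorem cast_fiberCard (f : Ω → α) (ω : Ω) :
    (fiberCard f ω : ℝ) = ∑ ω', if f ω' = f ω then (1 : ℝ) else 0 := by
  rw [Finset.sum_boole, fiberCard]

-- The numerator counts pairs (ω₁, ω₂) where ω₁ agrees with ω in f and h, and ω₂ in g and h. With
-- the pair fixed, the weights of all such ω sum to at most 1; the remaining weights of ω₂ in the
-- h-fibre of ω₁ sum to 1.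
open Classical in
theorem sum_fiberCard_quotient_le (f : Ω → α) (g : Ω → β) (h : Ω → γ) :
    ∑ ω, (fiberCard (fun ω => (f ω, h ω)) ω * fiberCard (fun ω => (g ω, h ω)) ω : ℝ) *
      ((fiberCard (fun ω => (f ω, g ω, h ω)) ω : ℝ)⁻¹ * (fiberCard h ω : ℝ)⁻¹) ≤
      Fintype.card Ω := by
  set m : Ω → ℝ := fun ω => (fiberCard (fun ω => (f ω, g ω, h ω)) ω : ℝ)⁻¹ with hm
  have hmul : ∀ ω, (fiberCard (fun ω => (f ω, h ω)) ω * fiberCard (fun ω => (g ω, h ω)) ω : ℝ) *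
      (m ω * (fiberCard h ω : ℝ)⁻¹) = ∑ ω₁, ∑ ω₂,
        (if h ω₂ = h ω₁ then (fiberCard h ω₁ : ℝ)⁻¹ else 0) *
          (if (f ω, g ω, h ω) = (f ω₁, g ω₂, h ω₁) then m ω else 0) := by
    intro ω
    rw [cast_fiberCard (fun ω => (f ω, h ω)), cast_fiberCard (fun ω => (g ω, h ω)),
      Finset.sum_mul_sum, Finset.sum_mul]
    refine Finset.sum_congr rfl fun ω₁ _ => ?_
    rw [Finset.sum_mul]
    refine Finset.sum_congr rfl fun ω₂ _ => ?_
    simp only [Prod.mk.injEq]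
    have hfib : h ω₁ = h ω → fiberCard h ω₁ = fiberCard h ω := fiberCard_eq_of_eq h
    split_ifs <;> grind
  rw [Finset.sum_congr rfl fun ω _ => hmul ω, Finset.sum_comm]
  calc _ = ∑ ω₁, ∑ ω₂, (if h ω₂ = h ω₁ then (fiberCard h ω₁ : ℝ)⁻¹ else 0) *
          ∑ ω, (if (f ω, g ω, h ω) = (f ω₁, g ω₂, h ω₁) then m ω else 0) := by
        refine Finset.sum_congr rfl fun ω₁ _ => ?_
        rw [Finset.sum_comm]
        simp only [Finset.mul_sum]
    _ ≤ ∑ ω₁, ∑ ω₂, (if h ω₂ = h ω₁ then (fiberCard h ω₁ : ℝ)⁻¹ else 0) * 1 := by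
        refine Finset.sum_le_sum fun ω₁ _ => Finset.sum_le_sum fun ω₂ _ => ?_
        refine mul_le_mul_of_nonneg_left ?_ (by split_ifs <;> positivity)
        refine (le_of_eq (Finset.sum_congr rfl fun ω _ => ?_)).trans
          (sum_inv_fiberCard_le_one (fun ω => (f ω, g ω, h ω)) (f ω₁, g ω₂, h ω₁))
        congr
    _ = ∑ _ω₁ : Ω, (1 : ℝ) := by
        refine Finset.sum_congr rfl fun ω₁ _ => ?_
        have hne : (fiberCard h ω₁ : ℝ) ≠ 0 := by exact_mod_cast (fiberCard_pos h ω₁).ne'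
        simp only [mul_one]
        rw [← Finset.sum_filter, Finset.sum_const, nsmul_eq_mul]
        exact mul_inv_cancel₀ hne
    _ = Fintype.card Ω := by simp

/-- Submodularity of entropy. -/
theorem entropy_submodular (f : Ω → α) (g : Ω → β) (h : Ω → γ) :
    entropy (fun ω => (f ω, g ω, h ω)) + entropy h ≤
      entropy (fun ω => (f ω, h ω)) + entropy (fun ω => (g ω, h ω)) := by
  unfold entropy
  rw [← add_div, ← add_div, ← Finset.sum_add_distrib, ← Finset.sum_add_distrib]
  have h2 : (0 : ℝ) ≤ Real.log 2 := Real.log_nonneg one_le_two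
  refine div_le_div_of_nonneg_right ?_ (by positivity)
  rw [← sub_nonneg, ← Finset.sum_sub_distrib]
  have key := sum_fiberCard_quotient_le f g h
  -- Pointwise log q ≤ q - 1 for the quotient q of fibre sizes, whose average is at most 1 by `key`.
  have hlog : ∀ ω, 1 - (fiberCard (fun ω => (f ω, h ω)) ω * fiberCard (fun ω => (g ω, h ω)) ω : ℝ) *
      ((fiberCard (fun ω => (f ω, g ω, h ω)) ω : ℝ)⁻¹ * (fiberCard h ω : ℝ)⁻¹) ≤
      (Real.log (Fintype.card Ω) - Real.log (fiberCard (fun ω => (f ω, h ω)) ω) +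
        (Real.log (Fintype.card Ω) - Real.log (fiberCard (fun ω => (g ω, h ω)) ω))) -
      (Real.log (Fintype.card Ω) - Real.log (fiberCard (fun ω => (f ω, g ω, h ω)) ω) +
        (Real.log (Fintype.card Ω) - Real.log (fiberCard h ω))) := by
    intro ω
    have p1 : (0 : ℝ) < fiberCard (fun ω => (f ω, h ω)) ω := by exact_mod_cast fiberCard_pos _ ω
    have p2 : (0 : ℝ) < fiberCard (fun ω => (g ω, h ω)) ω := by exact_mod_cast fiberCard_pos _ ω
    have p3 : (0 : ℝ) < fiberCard (fun ω => (f ω, g ω, h ω)) ω := by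
      exact_mod_cast fiberCard_pos _ ω
    have p4 : (0 : ℝ) < fiberCard h ω := by exact_mod_cast fiberCard_pos _ ω
    have := Real.log_le_sub_one_of_pos (mul_pos (mul_pos p1 p2) (mul_pos (inv_pos.2 p3)
      (inv_pos.2 p4)))
    rw [Real.log_mul (mul_pos p1 p2).ne' (mul_pos (inv_pos.2 p3) (inv_pos.2 p4)).ne',
      Real.log_mul p1.ne' p2.ne', Real.log_mul (inv_pos.2 p3).ne' (inv_pos.2 p4).ne',
      Real.log_inv, Real.log_inv] at this
    linarith
  refine le_trans ?_ (Finset.sum_le_sum fun ω _ => hlog ω)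
  rw [Finset.sum_sub_distrib]
  simp only [Finset.sum_const, Finset.card_univ, nsmul_eq_mul, mul_one]
  linarith

theorem entropy_eq_zero_of_const {f : Ω → α} (h : ∀ ω ω', f ω = f ω') : entropy f = 0 := by
  classical
  have : ∀ ω, fiberCard f ω = Fintype.card Ω := fun ω => by
    simp [fiberCard, h _ ω]
  simp [entropy, this]

theorem entropy_prod_le (f : Ω → α) (g : Ω → β) :
    entropy (fun ω => (f ω, g ω)) ≤ entropy f + entropy g := by
  have h := entropy_submodular f g fun _ => ()
  rw [entropy_eq_zero_of_const (f := fun _ : Ω => ()) fun _ _ => rfl, add_zero] at h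
  refine le_trans (le_of_eq (entropy_congr (by simp))) (h.trans (add_le_add ?_ ?_)) <;>
  exact entropy_le_of_determines (by simp)

theorem entropy_le_log_card [Fintype α] [Nonempty Ω] (f : Ω → α) :
    entropy f ≤ Real.log (Fintype.card α) / Real.log 2 := by
  classical
  have hΩ : (0 : ℝ) < Fintype.card Ω := Nat.cast_pos.2 Fintype.card_pos
  have hα : (0 : ℝ) < Fintype.card α := by
    exact_mod_cast Fintype.card_pos_iff.2 ⟨f (Classical.arbitrary Ω)⟩
  have h2 : (0 : ℝ) < Real.log 2 := Real.log_pos one_lt_two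
  rw [entropy, ← mul_div_mul_left (Real.log (Fintype.card α)) _ hΩ.ne']
  refine div_le_div_of_nonneg_right ?_ (by positivity)
  -- Again log q ≤ q - 1, now with q = |Ω| / (|α| c) for the fibre size c; the sum of 1/c counts
  -- attained values.
  have hlog : ∀ ω, Real.log (Fintype.card Ω) - Real.log (fiberCard f ω) ≤
      Real.log (Fintype.card α) +
        (Fintype.card Ω / Fintype.card α * (fiberCard f ω : ℝ)⁻¹ - 1) := by
    intro ω
    have p : (0 : ℝ) < fiberCard f ω := by exact_mod_cast fiberCard_pos f ω
    have := Real.log_le_sub_one_of_pos (mul_pos (div_pos hΩ hα) (inv_pos.2 p))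
    rw [Real.log_mul (div_pos hΩ hα).ne' (inv_pos.2 p).ne', Real.log_div hΩ.ne' hα.ne',
      Real.log_inv] at this
    linarith
  refine (Finset.sum_le_sum fun ω _ => hlog ω).trans ?_
  rw [Finset.sum_add_distrib, Finset.sum_sub_distrib, ← Finset.mul_sum]
  have hsum : ∑ ω, (fiberCard f ω : ℝ)⁻¹ ≤ Fintype.card α := by
    calc ∑ ω, (fiberCard f ω : ℝ)⁻¹
        = ∑ a : α, ∑ ω, (if f ω = a then ((fiberCard f ω : ℝ))⁻¹ else 0) := by
          rw [Finset.sum_comm]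
          simp
      _ ≤ ∑ _a : α, (1 : ℝ) := Finset.sum_le_sum fun a _ => sum_inv_fiberCard_le_one f a
      _ = Fintype.card α := by simp
  have hmul : (Fintype.card Ω / Fintype.card α : ℝ) * ∑ ω, (fiberCard f ω : ℝ)⁻¹ ≤
      Fintype.card Ω := by
    calc _ ≤ (Fintype.card Ω / Fintype.card α : ℝ) * Fintype.card α := by gcongr
      _ = _ := div_mul_cancel₀ _ hα.ne'
  simp only [Finset.sum_const, Finset.card_univ, nsmul_eq_mul, mul_one]
  linarith

theorem entropy_of_injective [Nonempty Ω] {f : Ω → α} (hf : Function.Injective f) :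
    entropy f = Real.log (Fintype.card Ω) / Real.log 2 := by
  classical
  have hΩ : (Fintype.card Ω : ℝ) ≠ 0 := by exact_mod_cast Fintype.card_ne_zero
  have : ∀ ω, fiberCard f ω = 1 := fun ω =>
    Finset.card_eq_one.2 ⟨ω, by ext; simp [hf.eq_iff]⟩
  simp [entropy, this, mul_div_mul_left, hΩ]

end Entropy

/-! ### Entropy conditioned on some of the bits of the files -/

section FileEntropy

variable {F L : ℕ} {α β : Type*}

/-- The bits of the files at the positions in `K`. -/
def bits (K : Finset (Fin F × Fin L)) (W : Files F L) : K → ZMod 2 := fun x => W x.1.1 x.1.2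

theorem bits_eq_iff {K : Finset (Fin F × Fin L)} {W W' : Files F L} :
    bits K W = bits K W' ↔ ∀ x ∈ K, W x.1 x.2 = W' x.1 x.2 := by
  simp [funext_iff, bits]

theorem entropy_bits_le (K : Finset (Fin F × Fin L)) : entropy (bits K) ≤ K.card := by
  refine (entropy_le_log_card _).trans (le_of_eq ?_)
  have h2 : Real.log 2 ≠ 0 := (Real.log_pos one_lt_two).ne'
  simp [ZMod.card, h2]

/-- All bits together have full entropy and the complement of `K` has at most its cardinality, so
subadditivity leaves at least `K.card` for `K`. This justifies subtracting `K.card` in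
`condEntropy`. -/
theorem entropy_bits (K : Finset (Fin F × Fin L)) : entropy (bits K) = K.card := by
  refine le_antisymm (entropy_bits_le K) ?_
  have h2 : Real.log 2 ≠ 0 := (Real.log_pos one_lt_two).ne'
  have h := entropy_prod_le (bits K) (bits Kᶜ)
  rw [entropy_of_injective] at h
  · have hc := entropy_bits_le Kᶜ
    have hcard := Finset.card_add_card_compl K
    have : Real.log (Fintype.card (Files F L)) / Real.log 2 = (K.card : ℝ) + Kᶜ.card := by
      rw [← Nat.cast_add, hcard]
      simp [ZMod.card, h2, ← pow_mul, mul_comm]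
    linarith
  · intro W W' hW
    simp only [Prod.mk.injEq, bits_eq_iff, Finset.mem_compl] at hW
    funext i x
    by_cases hx : (i, x) ∈ K
    · exact hW.1 _ hx
    · exact hW.2 _ hx

/-- The conditional entropy of `f`, given the bits at the positions in `K`. -/
noncomputable def condEntropy (f : Files F L → α) (K : Finset (Fin F × Fin L)) : ℝ :=
  entropy (fun W => (f W, bits K W)) - K.card

theorem condEntropy_nonneg (f : Files F L → α) (K : Finset (Fin F × Fin L)) :
    0 ≤ condEntropy f K := by
  rw [condEntropy, ← entropy_bits, sub_nonneg]
  exact entropy_le_of_determines (by simp)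

theorem condEntropy_empty (f : Files F L → α) : condEntropy f ∅ = entropy f := by
  rw [condEntropy, Finset.card_empty, Nat.cast_zero, sub_zero]
  exact entropy_congr (by simp [bits_eq_iff])

theorem condEntropy_congr {f : Files F L → α} {g : Files F L → β}
    (h : ∀ W W', f W = f W' ↔ g W = g W') (K : Finset (Fin F × Fin L)) :
    condEntropy f K = condEntropy g K := by
  rw [condEntropy, condEntropy, entropy_congr (g := fun W => (g W, bits K W)) (by simp [h])]

theorem condEntropy_eq_zero {f : Files F L → α} {K : Finset (Fin F × Fin L)}
    (h : ∀ W W', bits K W = bits K W' → f W = f W') : condEntropy f K = 0 := by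
  rw [condEntropy, ← entropy_bits, sub_eq_zero]
  refine entropy_congr fun W W' => ?_
  simp only [Prod.mk.injEq, and_iff_right_iff_imp]
  exact h W W'

theorem condEntropy_prod_le (f : Files F L → α) (g : Files F L → β)
    (K : Finset (Fin F × Fin L)) :
    condEntropy (fun W => (f W, g W)) K ≤ condEntropy f K + condEntropy g K := by
  have h := entropy_submodular f g (bits K)
  rw [entropy_bits] at h
  rw [condEntropy, condEntropy, condEntropy,
    entropy_congr (g := fun W => (f W, g W, bits K W)) (by simp [and_assoc])]
  linarith

theorem condEntropy_pi_le {ι : Type*} [DecidableEq ι] {A : ι → Type*}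
    (f : (n : ι) → Files F L → A n) (K : Finset (Fin F × Fin L)) (P : Finset ι) :
    condEntropy (fun W (n : P) => f n W) K ≤ ∑ n ∈ P, condEntropy (f n) K := by
  induction P using Finset.induction_on with
  | empty => exact (condEntropy_eq_zero fun W W' _ => funext fun n =>
      absurd n.2 (Finset.notMem_empty _)).le
  | insert n P hn ih =>
    rw [Finset.sum_insert hn]
    refine le_trans (le_of_eq ?_) ((condEntropy_prod_le (f n) (fun W (m : P) => f m W) K).trans
      (add_le_add le_rfl ih))
    refine condEntropy_congr (fun W W' => ?_) K
    simp [funext_iff]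

/-- Chain rule: if `g` is a function of `f` and of the bits in `B`, then the information in `f`
is at least the one in `g` and the one that `f` still has when the bits in `B` are known. -/
theorem condEntropy_add_le {f : Files F L → α} {g : Files F L → β}
    {B : Finset (Fin F × Fin L)} (hf : ∀ W W', f W = f W' → g W = g W')
    (hB : ∀ W W', bits B W = bits B W' → g W = g W') (K : Finset (Fin F × Fin L)) :
    condEntropy g K + condEntropy f (K ∪ B) ≤ condEntropy f K := by
  -- The common part is `g` with the bits in `K`; it is determined by `f` with these bits, and also
  -- by the bits in `K ∪ B`.
  have h := entropy_submodular f (bits (K ∪ B)) (fun W => (g W, bits K W))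
  have h1 : entropy (fun W => (f W, bits (K ∪ B) W, g W, bits K W)) =
      entropy fun W => (f W, bits (K ∪ B) W) := by
    refine entropy_congr fun W W' => ?_
    simp only [Prod.mk.injEq]
    refine ⟨fun h => ⟨h.1, h.2.1⟩, fun h => ⟨h.1, h.2, hf _ _ h.1, ?_⟩⟩
    rw [bits_eq_iff] at h ⊢
    exact fun x hx => h.2 x (Finset.mem_union_left _ hx)
  have h2 : entropy (fun W => (f W, g W, bits K W)) = entropy fun W => (f W, bits K W) := by
    refine entropy_congr fun W W' => ?_
    simp only [Prod.mk.injEq]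
    exact ⟨fun h => ⟨h.1, h.2.2⟩, fun h => ⟨h.1, hf _ _ h.1, h.2⟩⟩
  have h3 : entropy (fun W => (bits (K ∪ B) W, g W, bits K W)) = entropy (bits (K ∪ B)) := by
    refine entropy_congr fun W W' => ?_
    simp only [Prod.mk.injEq]
    refine ⟨fun h => h.1, fun h => ⟨h, hB _ _ ?_, ?_⟩⟩ <;> rw [bits_eq_iff] at h ⊢
    · exact fun x hx => h x (Finset.mem_union_right _ hx)
    · exact fun x hx => h x (Finset.mem_union_left _ hx)
  rw [h1, h2, h3, entropy_bits] at h
  unfold condEntropy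
  linarith

/-- Bits that are determined by `f` and the known bits can be split off. -/
theorem condEntropy_eq_add {f : Files F L → α} {K K' : Finset (Fin F × Fin L)} (hK : K ⊆ K')
    (h : ∀ W W', f W = f W' → bits K W = bits K W' → bits K' W = bits K' W') :
    condEntropy f K = (K' \ K).card + condEntropy f K' := by
  have h1 : entropy (fun W => (f W, bits K W)) = entropy fun W => (f W, bits K' W) := by
    refine entropy_congr fun W W' => ?_
    simp only [Prod.mk.injEq]
    refine ⟨fun hW => ⟨hW.1, h _ _ hW.1 hW.2⟩, fun hW => ⟨hW.1, ?_⟩⟩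
    rw [bits_eq_iff] at hW ⊢
    exact fun x hx => hW.2 x (hK hx)
  have h2 : ((K' \ K).card : ℝ) = K'.card - K.card := by
    rw [Finset.card_sdiff_of_subset hK, Nat.cast_sub (Finset.card_le_card hK)]
  rw [condEntropy, condEntropy, h1, h2]
  ring

end FileEntropy

end PIR

namespace PIR

/-! ### Laws of discrete random variables -/

theorem mutualInfo_eq_zero_iff {α β : Type} (p : PMF (α × β)) :
    mutualInfo p = 0 ↔
      p = (p.map Prod.fst).bind fun a => (p.map Prod.snd).map fun b => (a, b) := by
  let _ : MeasurableSpace (α × β) := ⊤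
  have : MeasurableSingletonClass (α × β) := ⟨fun _ => trivial⟩
  rw [mutualInfo, InformationTheory.klDiv_eq_zero_iff, PMF.toMeasure_inj]

theorem tsum_map_mul {α β : Type} (p : PMF α) (f : α → β) (φ : β → ℝ≥0∞) :
    ∑' b, p.map f b * φ b = ∑' a, p a * φ (f a) := by
  classical
  simp only [PMF.map_apply, ← ENNReal.tsum_mul_right]
  rw [ENNReal.tsum_comm]
  refine tsum_congr fun a => ?_
  rw [tsum_eq_single (f a)]
  · simp
  · intro b hb
    simp [hb]

theorem map_eq_of_comp {α β γ : Type} {p q : PMF α} {f : α → β} {g : β → γ} {k : α → γ}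
    (hk : k = g ∘ f) (h : p.map f = q.map f) : p.map k = q.map k := by
  rw [hk, ← PMF.map_comp, ← PMF.map_comp, h]

theorem uniformOfFintype_map_equiv {α : Type} [Fintype α] [Nonempty α] (e : α ≃ α) :
    (PMF.uniformOfFintype α).map e = PMF.uniformOfFintype α := by
  classical
  ext b
  rw [PMF.map_apply, tsum_eq_single (e.symm b)]
  · simp
  · intro a ha
    rw [if_neg]
    rintro rfl
    simp at ha

theorem mem_support_iid {α : Type} (p : PMF α) {m : ℕ} {w : Fin m → α}
    (hw : w ∈ (iid p m).support) (j : Fin m) : w j ∈ p.support := by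
  induction m with
  | zero => exact j.elim0
  | succ m ih =>
    simp only [iid, PMF.mem_support_bind_iff, PMF.mem_support_map_iff] at hw
    obtain ⟨a, ha, u, hu, rfl⟩ := hw
    refine Fin.cases ?_ (fun i => ?_) j
    · simpa using ha
    · simpa using ih hu i

/-- Peeling off the first sample; the target may vary with `j`, because a server sees a different
component of each run. -/
theorem iid_map {α : Type} (p : PMF α) {m : ℕ} {β : Fin (m + 1) → Type}
    (f : (j : Fin (m + 1)) → α → β j) :
    (iid p (m + 1)).map (fun w j => f j (w j)) =
      (p.map (f 0)).bind fun b =>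
        ((iid p m).map fun w (j : Fin m) => f j.succ (w j)).map fun u => Fin.cons b u := by
  rw [iid, PMF.map_bind, PMF.bind_map]
  congr 1
  funext a
  rw [PMF.map_comp, Function.comp_apply, PMF.map_comp]
  congr 1
  funext w j
  refine Fin.cases ?_ (fun i => ?_) j <;> simp

/-- The law of functions of the components of independent samples depends only on the laws of
these functions of one sample. -/
theorem iid_map_congr {α : Type} {p q : PMF α} {m : ℕ} {β : Fin m → Type}
    (f : (j : Fin m) → α → β j) (h : ∀ j, p.map (f j) = q.map (f j)) :
    (iid p m).map (fun w j => f j (w j)) = (iid q m).map (fun w j => f j (w j)) := by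
  induction m with
  | zero => rfl
  | succ m ih => rw [iid_map, iid_map, h 0, ih (fun j => f j.succ) fun j => h j.succ]

theorem map_fun_const {α β : Type} (p : PMF α) (b : β) : p.map (fun _ => b) = PMF.pure b :=
  p.map_const b

/-! ### Privacy, correctness and cost in terms of queries -/

namespace Scheme

variable {N F L : ℕ} (S : Scheme N F L)

/-- In a private scheme, the law of the query to a server does not depend on the desired index. -/
theorem IsPrivate.query_map_eq {S : Scheme N F L} (hS : S.IsPrivate) (n : Fin N) (θ θ' : Fin F) :
    (S.query θ).map (fun q => q n) = (S.query θ').map fun q => q n := by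
  have : Nonempty (Fin F) := ⟨θ⟩
  -- The uniform prior gives every index the same positive mass, which cancels at the end when the
  -- masses at `(θ, x)` are compared.
  have h := (mutualInfo_eq_zero_iff _).1 (hS (PMF.uniformOfFintype (Fin F)) n)
  have h1 := congrArg (PMF.map (Prod.map id fun x : (Σ q : S.Query n, (S.Ans n q → ZMod 2)) ×
    Content (S.stored n) => x.1.1)) h
  have h2 : (S.view (PMF.uniformOfFintype (Fin F)) n).map (Prod.map id
      fun x : (Σ q : S.Query n, (S.Ans n q → ZMod 2)) × Content (S.stored n) => x.1.1) =
      (PMF.uniformOfFintype (Fin F)).bind fun θ =>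
        ((S.query θ).map fun q => q n).map fun x => (θ, x) := by
    simp only [view, PMF.map_bind, PMF.map_comp, PMF.bind_const, Function.comp_def, Prod.map, id]
  have h3 : (S.view (PMF.uniformOfFintype (Fin F)) n).map Prod.fst =
      PMF.uniformOfFintype (Fin F) := by
    simp only [view, PMF.map_bind, PMF.map_comp, PMF.bind_const, Function.comp_def,
      map_fun_const, PMF.bind_pure]
  rw [h2, h3, PMF.map_bind] at h1
  simp only [PMF.map_comp, Function.comp_def, Prod.map, id] at h1
  set ρ : PMF (S.Query n) := (S.view (PMF.uniformOfFintype (Fin F)) n).map fun x => x.2.1.1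
    with hρ
  have key : ∀ θ : Fin F, (S.query θ).map (fun q => q n) = ρ := by
    intro θ
    classical
    ext x
    have h4 := congrArg (fun p => p (θ, x)) h1
    have h5 : ∀ (θ' : Fin F) (p : PMF (S.Query n)),
        p.map (fun y => (θ', y)) (θ, x) = if θ' = θ then p x else 0 := by
      intro θ' p
      rw [PMF.map_apply]
      split_ifs with hθ
      · subst hθ
        rw [tsum_eq_single x]
        · simp
        · intro y hy
          simp [hy.symm]
      · simp [Ne.symm hθ]
    have h6 : (fun θ => (S.query θ).map fun q => (θ, q n)) =
        fun θ => ((S.query θ).map fun q => q n).map fun y => (θ, y) := by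
      funext θ
      rw [PMF.map_comp]
      rfl
    have h7 : (fun θ : Fin F => (S.view (PMF.uniformOfFintype (Fin F)) n).map fun y => (θ, y.2.1.1)) =
        fun θ : Fin F => ρ.map fun y => (θ, y) := by
      funext θ
      rw [hρ, PMF.map_comp]
      rfl
    rw [h6, h7] at h4
    simp only [PMF.bind_apply, h5] at h4
    rw [tsum_eq_single θ (by simp +contextual), tsum_eq_single θ (by simp +contextual), if_pos rfl,
      if_pos rfl] at h4
    refine (ENNReal.mul_right_inj ?_ ?_).1 h4 <;> simp [θ.pos.ne']
  rw [key, key]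

/-- A scheme is private if the laws of the queries do not depend on the desired index. -/
theorem isPrivate_of_query_map_eq
    (h : ∀ (n : Fin N) (θ θ' : Fin F),
      (S.query θ).map (fun q => q n) = (S.query θ').map fun q => q n) : S.IsPrivate := by
  intro p n
  rw [mutualInfo_eq_zero_iff]
  obtain ⟨θ₀, -⟩ := p.support_nonempty
  -- The law of what the server sees for a reference index `θ₀`; for fixed files it is an image of
  -- the query law, hence the same for every index.
  set κ : PMF ((Σ q : S.Query n, (S.Ans n q → ZMod 2)) × Content (S.stored n)) :=
    (PMF.uniformOfFintype (Files F L)).bind fun W => (S.query θ₀).map fun q =>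
      (⟨q n, S.answer n (q n) (S.content n W)⟩, S.content n W) with hκ
  have hview : S.view p n = p.bind fun θ => κ.map fun x => (θ, x) := by
    rw [view]
    congr 1
    funext θ
    rw [hκ, PMF.map_bind]
    congr 1
    funext W
    rw [PMF.map_comp]
    let g : S.Query n → Fin F × ((Σ q : S.Query n, (S.Ans n q → ZMod 2)) × Content (S.stored n)) :=
      fun x => (θ, (⟨x, S.answer n x (S.content n W)⟩, S.content n W))
    exact map_eq_of_comp (g := g) rfl (h n θ θ₀)
  have h1 : (S.view p n).map Prod.fst = p := by
    simp only [hview, PMF.map_bind, PMF.map_comp, Function.comp_def, map_fun_const, PMF.bind_pure]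
  have h2 : (S.view p n).map Prod.snd = κ := by
    simp only [hview, PMF.map_bind, PMF.map_comp, Function.comp_def]
    exact (PMF.bind_const _ _).trans (PMF.map_id _)
  rw [h1, h2, hview]

/-- Correctness means that the queries and answers determine the desired file. -/
theorem isCorrect_iff : S.IsCorrect ↔ ∀ θ : Fin F, ∀ q ∈ (S.query θ).support,
    ∀ W W' : Files F L,
      (∀ n, S.answer n (q n) (S.content n W) = S.answer n (q n) (S.content n W')) →
        W θ = W' θ := by
  classical
  constructor
  · intro h θ q hq W W' hW
    obtain ⟨d, hd⟩ := h θ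
    rw [← hd q hq W, ← hd q hq W']
    congr 1
    funext n
    rw [hW n]
  · intro h θ
    -- The decoder picks any files consistent with the transcript. The transcript contains the
    -- queries, so the chosen queries are the actual ones.
    refine ⟨fun d => if hd : ∃ W : Files F L, ∃ q ∈ (S.query θ).support,
      d = fun n => ⟨q n, S.answer n (q n) (S.content n W)⟩ then hd.choose θ else 0, ?_⟩
    intro q hq W
    have hd : ∃ W' : Files F L, ∃ q' ∈ (S.query θ).support,
      (fun n => (⟨q n, S.answer n (q n) (S.content n W)⟩ : Σ x : S.Query n, (S.Ans n x → ZMod 2))) =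
        fun n => ⟨q' n, S.answer n (q' n) (S.content n W')⟩ := ⟨W, q, hq, rfl⟩
    refine (dif_pos hd).trans ?_
    obtain ⟨q', hq', he⟩ := hd.choose_spec
    have hqq : q = q' := funext fun n => congrArg Sigma.fst (congrFun he n)
    subst hqq
    refine (h θ q hq _ _ fun n => ?_).symm
    exact eq_of_heq (Sigma.mk.inj (congrFun he n)).2

/-- If the number of downloaded bits is always `D`, then the download cost is `D`. -/
theorem downloadCost_eq [Nonempty (Fin F)] {D : ℕ}
    (h : ∀ θ : Fin F, ∀ q ∈ (S.query θ).support, S.downloadedBits q = D) :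
    S.downloadCost = D := by
  have h1 : ∀ θ : Fin F, ∑' q, S.query θ q * (S.downloadedBits q : ℝ≥0∞) = D := by
    intro θ
    rw [← one_mul (D : ℝ≥0∞), ← (S.query θ).tsum_coe, ← ENNReal.tsum_mul_right]
    refine tsum_congr fun q => ?_
    by_cases hq : S.query θ q = 0
    · simp [hq]
    · rw [h θ q ((S.query θ).mem_support_iff q |>.2 hq)]
  simp [downloadCost, h1]

end Scheme

end PIR

namespace PIR

namespace Scheme

/-! ### The converse bound -/

variable {N F L : ℕ} (S : Scheme N F L)

/-- The bit at position `x` is stored on none of the servers in `P`. -/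
def Missed (P : Finset (Fin N)) (x : Fin F × Fin L) : Prop := ∀ n ∈ P, x.2 ∉ S.stored n x.1

instance (P : Finset (Fin N)) : DecidablePred (S.Missed P) := fun _ => by
  unfold Missed
  infer_instance

/-- The number of servers that store the bit at position `x`. -/
def copies (x : Fin F × Fin L) : ℕ := (Finset.univ.filter fun n => x.2 ∈ S.stored n x.1).card

/-- The positions of the bits of the first `k` files and of the bits stored on servers in `P`. -/
def knownBits (k : ℕ) (P : Finset (Fin N)) : Finset (Fin F × Fin L) :=
  Finset.univ.filter fun x => x.1.1 < k ∨ ¬S.Missed P x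

/-- The answers of all servers to the queries `q`. -/
def answers (q : (n : Fin N) → S.Query n) (W : Files F L) (n : Fin N) : S.Ans n (q n) → ZMod 2 :=
  S.answer n (q n) (S.content n W)

/-- The conditional entropy of the answers when file `θ` is desired, given the queries, the first
`k` files and the contents of the servers in `P`. -/
noncomputable def ambiguity (θ : Fin F) (k : ℕ) (P : Finset (Fin N)) : ℝ≥0∞ :=
  ∑' q, S.query θ q * ENNReal.ofReal (condEntropy (S.answers q) (S.knownBits k P))

/-- The conditional entropy of the answer of server `n` when file `θ` is desired, given the query,
the first `k` files and the contents of the servers in `P`. -/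
noncomputable def serverAmbiguity (θ : Fin F) (n : Fin N) (k : ℕ) (P : Finset (Fin N)) : ℝ≥0∞ :=
  ∑' q, S.query θ q *
    ENNReal.ofReal (condEntropy (fun W => S.answers q W n) (S.knownBits k P))

/-- The lower bound for the ambiguity of the answers that remains when the files up to `k` and the
contents of the servers in `P` are known. -/
noncomputable def missedWeight (k : ℕ) (P : Finset (Fin N)) : ℝ :=
  ∑ x : Fin F × Fin L, if k < x.1.1 ∧ S.Missed P x then ((S.copies x : ℝ)⁻¹) ^ (x.1.1 - k) else 0

theorem mem_knownBits {k : ℕ} {P : Finset (Fin N)} {x : Fin F × Fin L} :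
    x ∈ S.knownBits k P ↔ x.1.1 < k ∨ ∃ n ∈ P, x.2 ∈ S.stored n x.1 := by
  simp [knownBits, Missed]

theorem answer_eq_of_bits {q : (n : Fin N) → S.Query n} {n : Fin N} {W W' : Files F L}
    (h : ∀ x : Fin F × Fin L, x.2 ∈ S.stored n x.1 → W x.1 x.2 = W' x.1 x.2) :
    S.answers q W n = S.answers q W' n := by
  have : S.content n W = S.content n W' := by
    funext i x
    exact h (i, x.1) x.2
  rw [answers, answers, this]

/-- The answer of server `n` is a function of all answers and also of its content, so
`condEntropy_add_le` applies with that content as `B`. -/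
theorem condEntropy_answer_add_le (q : (n : Fin N) → S.Query n) (n : Fin N) (k : ℕ)
    (P : Finset (Fin N)) :
    condEntropy (fun W => S.answers q W n) (S.knownBits k P) +
      condEntropy (S.answers q) (S.knownBits k (insert n P)) ≤
      condEntropy (S.answers q) (S.knownBits k P) := by
  have hK : S.knownBits k (insert n P) =
      S.knownBits k P ∪ Finset.univ.filter fun x => x.2 ∈ S.stored n x.1 := by
    ext x
    simp only [mem_knownBits, Finset.mem_union, Finset.mem_filter, Finset.mem_univ, true_and,
      Finset.exists_mem_insert]
    rw [or_assoc, or_comm (a := x.2 ∈ S.stored n x.1)]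
  rw [hK]
  refine condEntropy_add_le (fun W W' h => congrFun h n) (fun W W' h => ?_) _
  rw [bits_eq_iff] at h
  exact S.answer_eq_of_bits fun x hx => h x (by simpa using hx)

theorem condEntropy_answers_le_sum (q : (n : Fin N) → S.Query n) (k : ℕ) (P : Finset (Fin N)) :
    condEntropy (S.answers q) (S.knownBits k P) ≤
      ∑ n ∈ Pᶜ, condEntropy (fun W => S.answers q W n) (S.knownBits k P) := by
  have h := condEntropy_pi_le (fun n W => S.answers q W n) (S.knownBits k P) Finset.univ
  rw [← Finset.sum_compl_add_sum P, Finset.sum_eq_zero (s := P), add_zero] at h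
  · refine le_trans (le_of_eq (condEntropy_congr (fun W W' => ?_) _)) h
    simp [funext_iff]
  · intro n hn
    refine condEntropy_eq_zero fun W W' hW => S.answer_eq_of_bits fun x hx => ?_
    rw [bits_eq_iff] at hW
    exact hW x (S.mem_knownBits.2 (Or.inr ⟨n, hn, hx⟩))

/-- The answers reveal file θ, so its bits not yet known, those missed by `P`, split off in full. -/
theorem condEntropy_answers_eq_add (hS : S.IsCorrect) {θ : Fin F} {q : (n : Fin N) → S.Query n}
    (hq : q ∈ (S.query θ).support) (P : Finset (Fin N)) :
    condEntropy (S.answers q) (S.knownBits θ P) =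
      (Finset.univ.filter fun x : Fin F × Fin L => x.1 = θ ∧ S.Missed P x).card +
      condEntropy (S.answers q) (S.knownBits (θ + 1) P) := by
  have hsub : S.knownBits θ P ⊆ S.knownBits (θ + 1) P := by
    intro x
    rw [mem_knownBits, mem_knownBits]
    exact Or.imp_left Nat.lt_succ_of_lt
  have hdiff : S.knownBits (θ + 1) P \ S.knownBits θ P =
      Finset.univ.filter fun x : Fin F × Fin L => x.1 = θ ∧ S.Missed P x := by
    ext x
    simp only [knownBits, Finset.mem_sdiff, Finset.mem_filter, Finset.mem_univ, true_and,
      Fin.ext_iff]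
    constructor
    · rintro ⟨h1, h2⟩
      rw [not_or, not_not] at h2
      exact ⟨by have := h1.resolve_right (not_not.2 h2.2); omega, h2.2⟩
    · rintro ⟨h1, h2⟩
      refine ⟨Or.inl (by omega), ?_⟩
      rw [not_or, not_not]
      exact ⟨by omega, h2⟩
  rw [← hdiff]
  refine condEntropy_eq_add hsub fun W W' hW hK => ?_
  have hθ := S.isCorrect_iff.1 hS θ q hq W W' fun n => congrFun hW n
  rw [bits_eq_iff] at hK ⊢
  intro x hx
  rw [mem_knownBits] at hx
  rcases hx with hx | hx
  · rcases Nat.lt_succ_iff_lt_or_eq.1 hx with h | h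
    · exact hK x (S.mem_knownBits.2 (Or.inl h))
    · rw [Fin.ext h, hθ]
  · exact hK x (S.mem_knownBits.2 (Or.inr hx))

/-! ### Recursion for the ambiguity, averaged over the queries -/

theorem serverAmbiguity_add_le (θ : Fin F) (n : Fin N) (k : ℕ) (P : Finset (Fin N)) :
    S.serverAmbiguity θ n k P + S.ambiguity θ k (insert n P) ≤ S.ambiguity θ k P := by
  rw [serverAmbiguity, ambiguity, ambiguity, ← ENNReal.tsum_add]
  refine ENNReal.tsum_le_tsum fun q => ?_
  rw [← mul_add, ← ENNReal.ofReal_add (condEntropy_nonneg _ _) (condEntropy_nonneg _ _)]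
  gcongr
  exact S.condEntropy_answer_add_le q n k P

theorem ambiguity_le_sum (θ : Fin F) (k : ℕ) (P : Finset (Fin N)) :
    S.ambiguity θ k P ≤ ∑ n ∈ Pᶜ, S.serverAmbiguity θ n k P := by
  simp only [serverAmbiguity, ambiguity]
  rw [← Summable.tsum_finsetSum fun _ _ => ENNReal.summable]
  refine ENNReal.tsum_le_tsum fun q => ?_
  rw [← Finset.mul_sum, ← ENNReal.ofReal_sum_of_nonneg fun _ _ => condEntropy_nonneg _ _]
  gcongr
  exact S.condEntropy_answers_le_sum q k P

variable {S}

/-- The only use of privacy in the converse: the averaged quantity depends on the query to server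
`n` alone. -/
theorem IsPrivate.serverAmbiguity_eq (hS : S.IsPrivate) (θ θ' : Fin F) (n : Fin N) (k : ℕ)
    (P : Finset (Fin N)) : S.serverAmbiguity θ n k P = S.serverAmbiguity θ' n k P := by
  let φ : S.Query n → ℝ≥0∞ := fun x => ENNReal.ofReal
    (condEntropy (fun W => S.answer n x (S.content n W)) (S.knownBits k P))
  have h : ∀ θ, S.serverAmbiguity θ n k P = ∑' x, (S.query θ).map (fun q => q n) x * φ x :=
    fun θ => (tsum_map_mul (S.query θ) (fun q => q n) φ).symm
  rw [h, h, hS.query_map_eq n θ θ']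

theorem IsCorrect.ambiguity_eq_add (hS : S.IsCorrect) (θ : Fin F) (P : Finset (Fin N)) :
    S.ambiguity θ θ P =
      ENNReal.ofReal (Finset.univ.filter fun x : Fin F × Fin L => x.1 = θ ∧ S.Missed P x).card +
      S.ambiguity θ (θ + 1) P := by
  rw [ambiguity, ambiguity, ← one_mul (ENNReal.ofReal (Finset.card _ : ℝ)),
    ← (S.query θ).tsum_coe, ← ENNReal.tsum_mul_right, ← ENNReal.tsum_add]
  refine tsum_congr fun q => ?_
  by_cases hq : S.query θ q = 0
  · simp [hq]
  · rw [S.condEntropy_answers_eq_add hS ((S.query θ).mem_support_iff q |>.2 hq) P, ← mul_add,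
      ENNReal.ofReal_add (Nat.cast_nonneg _) (condEntropy_nonneg _ _)]

theorem ambiguity_add_sum_le (hp : S.IsPrivate) (θ θ' : Fin F) (k : ℕ) (P : Finset (Fin N)) :
    S.ambiguity θ' k P + ∑ n ∈ Pᶜ, S.ambiguity θ k (insert n P) ≤
      Pᶜ.card * S.ambiguity θ k P := by
  calc _ ≤ ∑ n ∈ Pᶜ, S.serverAmbiguity θ' n k P + ∑ n ∈ Pᶜ, S.ambiguity θ k (insert n P) :=
        add_le_add (S.ambiguity_le_sum θ' k P) le_rfl
    _ = ∑ n ∈ Pᶜ, (S.serverAmbiguity θ n k P + S.ambiguity θ k (insert n P)) := by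
        rw [Finset.sum_add_distrib]
        congr 1
        exact Finset.sum_congr rfl fun n _ => hp.serverAmbiguity_eq _ _ n k P
    _ ≤ ∑ _n ∈ Pᶜ, S.ambiguity θ k P :=
        Finset.sum_le_sum fun n _ => S.serverAmbiguity_add_le θ n k P
    _ = _ := by rw [Finset.sum_const, nsmul_eq_mul]

/-! ### The weights of the missed bits satisfy the matching recursion -/

variable (S)

theorem missedWeight_nonneg (k : ℕ) (P : Finset (Fin N)) : 0 ≤ S.missedWeight k P :=
  Finset.sum_nonneg fun x _ => by split_ifs <;> positivity

/-- All copies of a bit missed by `P` lie outside `P`; adding a server uncovers the bit exactly if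
it stores a copy. -/
theorem card_filter_missed_insert_add_copies {P : Finset (Fin N)} {x : Fin F × Fin L}
    (h : S.Missed P x) :
    (Pᶜ.filter fun n => S.Missed (insert n P) x).card + S.copies x = Pᶜ.card := by
  rw [← Finset.card_filter_add_card_filter_not (s := Pᶜ) fun n => S.Missed (insert n P) x, copies]
  congr 2
  ext n
  simp only [Missed] at h
  simp only [Missed, Finset.mem_filter, Finset.mem_univ, true_and, Finset.mem_compl,
    Finset.forall_mem_insert, not_and_or, not_not]
  exact ⟨fun hn => ⟨fun hP => h n hP hn, Or.inl hn⟩, fun hn => hn.2.resolve_right fun h' => h' h⟩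

/-- Holds bit by bit. For a missed bit with s copies in file k + 1 + e, the servers outside `P`
without a copy account for the last sum. The s others contribute s · s^{-(e+1)} ≤ s^{-e}, covered by
the cardinality if e = 0 and by `missedWeight (k + 1)` otherwise. -/
theorem card_mul_missedWeight_le (k : ℕ) (P : Finset (Fin N)) :
    Pᶜ.card * S.missedWeight k P ≤
      (Finset.univ.filter fun x : Fin F × Fin L => x.1.1 = k + 1 ∧ S.Missed P x).card +
        S.missedWeight (k + 1) P + ∑ n ∈ Pᶜ, S.missedWeight k (insert n P) := by
  simp only [missedWeight]
  rw [Finset.sum_comm, ← Finset.sum_boole, Finset.mul_sum, ← Finset.sum_add_distrib,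
    ← Finset.sum_add_distrib]
  refine Finset.sum_le_sum fun x _ => ?_
  set s : ℝ := (S.copies x : ℝ)
  have hs0 : 0 ≤ s := Nat.cast_nonneg _
  by_cases hP : S.Missed P x
  swap
  · simp only [hP, and_false, if_false, mul_zero]
    have : ∀ n ∈ Pᶜ, (0 : ℝ) ≤
        if k < x.1.1 ∧ S.Missed (insert n P) x then s⁻¹ ^ (x.1.1 - k) else 0 := fun n _ => by
      split_ifs <;> positivity
    linarith [Finset.sum_nonneg this]
  by_cases hk : k < x.1.1
  swap
  · have h1 : ¬ (x.1.1 = k + 1) := by omega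
    have h2 : ¬ (k + 1 < x.1.1) := by omega
    simp [hk, h1, h2]
  simp only [hP, hk, and_true, true_and, if_true]
  rw [← Finset.sum_filter, Finset.sum_const, nsmul_eq_mul,
    ← S.card_filter_missed_insert_add_copies hP, Nat.cast_add, add_mul, add_comm]
  refine add_le_add ?_ le_rfl
  obtain ⟨e, he⟩ : ∃ e, x.1.1 - k = e + 1 := ⟨x.1.1 - k - 1, by omega⟩
  have hle : s * s⁻¹ ^ (e + 1) ≤ s⁻¹ ^ e := by
    rw [pow_succ', ← mul_assoc]
    exact mul_le_of_le_one_left (by positivity) mul_inv_le_one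
  rw [he]
  refine hle.trans ?_
  rcases e with _ | e
  · have h1 : x.1.1 = k + 1 := by omega
    simp [h1]
  · have h1 : ¬ (x.1.1 = k + 1) := by omega
    have h2 : k + 1 < x.1.1 := by omega
    have h3 : x.1.1 - (k + 1) = e + 1 := by omega
    simp [h1, h2, h3]

theorem missedWeight_univ (k : ℕ) : S.missedWeight k Finset.univ = 0 := by
  refine Finset.sum_eq_zero fun x _ => ?_
  split_ifs with h
  · have h0 : S.copies x = 0 := by
      rw [copies, Finset.card_eq_zero, Finset.filter_eq_empty_iff]
      exact fun n _ => h.2 n (Finset.mem_univ n)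
    -- A bit missed by all servers has no copy; with `0⁻¹ = 0` and a positive exponent its weight
    -- vanishes.
    rw [h0, Nat.cast_zero, inv_zero, zero_pow (by omega)]
  · rfl

variable {S}

/-- Outer induction on the number `m` of files after θ, inner one on the number of servers outside
`P`. The recursion is used with θ' = θ + 1 and k = θ + 1, so that correctness for θ' applies to its
first term. -/
theorem missedWeight_le_ambiguity (hc : S.IsCorrect) (hp : S.IsPrivate) (m : ℕ) :
    ∀ θ : Fin F, F = θ + 1 + m → ∀ P : Finset (Fin N),
      ENNReal.ofReal (S.missedWeight θ P) ≤ S.ambiguity θ (θ + 1) P := by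
  induction m with
  | zero =>
    intro θ hθ P
    have : S.missedWeight θ P = 0 := Finset.sum_eq_zero fun x _ => if_neg fun h => by
      have := x.1.2
      omega
    simp [this]
  | succ m ih =>
    intro θ hθ P
    let θ' : Fin F := ⟨θ + 1, by omega⟩
    induction hcard : Pᶜ.card generalizing P with
    | zero =>
      rw [Finset.card_eq_zero, Finset.compl_eq_empty_iff] at hcard
      rw [hcard, missedWeight_univ, ENNReal.ofReal_zero]
      exact zero_le
    | succ c ihc =>
      have h1 := ambiguity_add_sum_le hp θ θ' (θ + 1) P
      have h2 := hc.ambiguity_eq_add θ' P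
      have h3 := ih θ' (by simp only [θ']; omega) P
      have h4 : ∀ n ∈ Pᶜ, ENNReal.ofReal (S.missedWeight θ (insert n P)) ≤
          S.ambiguity θ (θ + 1) (insert n P) := by
        intro n hn
        refine ihc _ ?_
        rw [Finset.compl_insert, Finset.card_erase_of_mem hn, hcard, Nat.add_sub_cancel]
      have h5 : ENNReal.ofReal (Pᶜ.card * S.missedWeight θ P) ≤
          Pᶜ.card * S.ambiguity θ (θ + 1) P := by
        refine le_trans (ENNReal.ofReal_le_ofReal (S.card_mul_missedWeight_le θ P)) ?_
        refine le_trans ?_ h1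
        rw [ENNReal.ofReal_add (add_nonneg (Nat.cast_nonneg _) (S.missedWeight_nonneg _ _))
          (Finset.sum_nonneg fun _ _ => S.missedWeight_nonneg _ _),
          ENNReal.ofReal_add (Nat.cast_nonneg _) (S.missedWeight_nonneg _ _),
          ENNReal.ofReal_sum_of_nonneg fun _ _ => S.missedWeight_nonneg _ _]
        refine add_le_add ?_ (Finset.sum_le_sum h4)
        change _ ≤ S.ambiguity θ' θ' P
        rw [h2]
        refine add_le_add (le_of_eq ?_) h3
        congr 3
        ext x
        simp [θ', Fin.ext_iff]
      rw [ENNReal.ofReal_mul (Nat.cast_nonneg _), ENNReal.ofReal_natCast] at h5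
      -- Cancelling the factor `Pᶜ.card`, which is positive in this case.
      refine (ENNReal.mul_le_mul_iff_right ?_ (ENNReal.natCast_ne_top _)).1 h5
      rw [hcard]
      exact_mod_cast Nat.succ_ne_zero c

/-- Otherwise flipping an unstored bit of the zero files would change no answer. -/
theorem IsCorrect.copies_pos (hc : S.IsCorrect) (x : Fin F × Fin L) : 0 < S.copies x := by
  classical
  rw [copies, Finset.card_pos]
  by_contra hne
  rw [Finset.not_nonempty_iff_eq_empty, Finset.filter_eq_empty_iff] at hne
  obtain ⟨q, hq⟩ := (S.query x.1).support_nonempty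
  have h := S.isCorrect_iff.1 hc x.1 q hq 0 (fun i y => if (i, y) = x then 1 else 0) fun n => by
    congr 1
    funext i y
    have : (i, y.1) ≠ x := by
      rintro rfl
      exact hne (Finset.mem_univ n) y.2
    simp [content, this]
  have h' := congrFun h x.2
  simp at h'

theorem entropy_answers_le (q : (n : Fin N) → S.Query n) :
    entropy (S.answers q) ≤ S.downloadedBits q := by
  classical
  refine (entropy_le_log_card (S.answers q)).trans (le_of_eq ?_)
  have h2 : Real.log 2 ≠ 0 := (Real.log_pos one_lt_two).ne'
  simp [ZMod.card, downloadedBits, Finset.prod_pow_eq_pow_sum, h2]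

/-- The average of `s⁻¹ ^ m` is at least `t⁻¹ ^ m` if the average of the positive numbers `s`
is `t`. -/
theorem card_mul_inv_pow_le_sum {ι : Type*} (X : Finset ι) (s : ι → ℝ) (hs : ∀ x ∈ X, 0 < s x)
    {t : ℝ} (ht : 0 < t) (hsum : ∑ x ∈ X, s x = t * X.card) (m : ℕ) :
    X.card * t⁻¹ ^ m ≤ ∑ x ∈ X, (s x)⁻¹ ^ m := by
  -- Tangent line at t: by Bernoulli, (t/s)^m ≥ 1 + m(t/s - 1) ≥ 1 + m(1 - s/t). The last expression
  -- is affine in s and averages to 1.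
  have key : ∀ x ∈ X, t⁻¹ ^ m * (1 + m * (1 - s x / t)) ≤ (s x)⁻¹ ^ m := by
    intro x hx
    have h0 := hs x hx
    have h1 : (s x)⁻¹ ^ m = t⁻¹ ^ m * (t / s x) ^ m := by
      rw [← mul_pow]
      congr 1
      field_simp
    rw [h1]
    refine mul_le_mul_of_nonneg_left ?_ (by positivity)
    have h2 := one_add_mul_le_pow (a := t / s x - 1) (by linarith [div_pos ht h0]) m
    rw [add_sub_cancel] at h2
    refine le_trans ?_ h2
    have h3 : 1 - s x / t ≤ t / s x - 1 := by
      have h4 : (t / s x - 1) - (1 - s x / t) = (t - s x) ^ 2 / (s x * t) := by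
        field_simp
      have h5 : 0 ≤ (t - s x) ^ 2 / (s x * t) := by positivity
      linarith
    gcongr
  refine le_trans (le_of_eq ?_) (Finset.sum_le_sum key)
  rw [← Finset.mul_sum, Finset.sum_add_distrib, ← Finset.mul_sum, Finset.sum_sub_distrib,
    ← Finset.sum_div, hsum, Finset.sum_const, nsmul_eq_mul, mul_div_cancel_left₀ _ ht.ne']
  ring

theorem sum_copies {t : ℕ} (hN : 0 < N) (hst : S.HasStorage ((t : ℝ) / N)) (i : Fin F) :
    ∑ x : Fin L, (S.copies (i, x) : ℝ) = t * L := by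
  have h : ∑ x : Fin L, S.copies (i, x) = ∑ n : Fin N, (S.stored n i).card := by
    simp only [copies, Finset.card_filter]
    rw [Finset.sum_comm]
    refine Finset.sum_congr rfl fun n _ => ?_
    rw [← Finset.card_filter]
    congr 1
    ext
    simp
  rw [← Nat.cast_sum, h, Nat.cast_sum, Finset.sum_congr rfl fun n _ => hst n i]
  have : (N : ℝ) ≠ 0 := by exact_mod_cast hN.ne'
  simp only [Finset.sum_const, Finset.card_univ, Fintype.card_fin, nsmul_eq_mul]
  field_simp

/-- The converse bound: the download cost is at least the file size divided by the capacity. -/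
theorem le_downloadCost {t : ℕ} (hF : 0 < F) (ht : 0 < t) (hN : 0 < N)
    (hst : S.HasStorage ((t : ℝ) / N)) (hc : S.IsCorrect) (hp : S.IsPrivate) :
    ENNReal.ofReal (∑ f ∈ Finset.range F, L * (t : ℝ)⁻¹ ^ f) ≤ S.downloadCost := by
  let θ : Fin F := ⟨0, hF⟩
  have h1 : S.ambiguity θ θ ∅ ≤ S.downloadCost := by
    refine le_trans ?_ (le_iSup _ θ)
    refine ENNReal.tsum_le_tsum fun q => ?_
    gcongr
    have h0 : S.knownBits θ ∅ = ∅ := by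
      ext x
      simp [mem_knownBits, θ]
    rw [h0, condEntropy_empty]
    exact ENNReal.ofReal_le_natCast.2 (entropy_answers_le q)
  refine le_trans ?_ h1
  rw [hc.ambiguity_eq_add θ ∅]
  refine le_trans ?_ (add_le_add le_rfl
    (missedWeight_le_ambiguity hc hp (F - 1) θ (by simp only [θ]; omega) ∅))
  rw [← ENNReal.ofReal_add (Nat.cast_nonneg _) (S.missedWeight_nonneg _ _)]
  refine ENNReal.ofReal_le_ofReal ?_
  -- The desired file has index 0 and exponent 0: each of its bits counts 1, as in the correctness
  -- term.
  have h2 : ((Finset.univ.filter fun x : Fin F × Fin L => x.1 = θ ∧ S.Missed ∅ x).card : ℝ) +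
      S.missedWeight θ ∅ = ∑ i : Fin F, ∑ x : Fin L, ((S.copies (i, x) : ℝ))⁻¹ ^ i.1 := by
    rw [missedWeight, ← Finset.sum_boole, ← Finset.sum_add_distrib, Fintype.sum_prod_type]
    refine Finset.sum_congr rfl fun i _ => Finset.sum_congr rfl fun x _ => ?_
    rcases Nat.eq_zero_or_pos i.1 with h | h
    · simp [θ, Missed, Fin.ext_iff, h]
    · simp [θ, Missed, Fin.ext_iff, h, h.ne']
  rw [h2, ← Fin.sum_univ_eq_sum_range fun f => (L : ℝ) * (t : ℝ)⁻¹ ^ f]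
  refine Finset.sum_le_sum fun i _ => ?_
  have h3 := card_mul_inv_pow_le_sum (Finset.univ : Finset (Fin L))
    (fun x => (S.copies (i, x) : ℝ)) (fun x _ => Nat.cast_pos.2 (hc.copies_pos _))
    (Nat.cast_pos.2 ht) (by rw [sum_copies hN hst, Finset.card_univ, Fintype.card_fin]) i.1
  rwa [Finset.card_univ, Fintype.card_fin] at h3

theorem rate_le {t : ℕ} (hF : 0 < F) (ht : 0 < t) (hN : 0 < N) (hL : 0 < L)
    (hst : S.HasStorage ((t : ℝ) / N)) (hc : S.IsCorrect) (hp : S.IsPrivate) :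
    S.rate ≤ (∑ f ∈ Finset.range F, ((t : ℝ≥0∞) ^ f)⁻¹)⁻¹ := by
  have h := le_downloadCost hF ht hN hst hc hp
  have ht' : (0 : ℝ) < t := Nat.cast_pos.2 ht
  have h1 : ENNReal.ofReal (∑ f ∈ Finset.range F, L * (t : ℝ)⁻¹ ^ f) =
      L * ∑ f ∈ Finset.range F, ((t : ℝ≥0∞) ^ f)⁻¹ := by
    rw [ENNReal.ofReal_sum_of_nonneg fun _ _ => by positivity, Finset.mul_sum]
    refine Finset.sum_congr rfl fun f _ => ?_
    rw [ENNReal.ofReal_mul (Nat.cast_nonneg _), ENNReal.ofReal_pow (by positivity),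
      ENNReal.ofReal_inv_of_pos ht', ENNReal.ofReal_natCast, ENNReal.ofReal_natCast,
      ENNReal.inv_pow]
  rw [h1] at h
  have hL0 : (L : ℝ≥0∞) ≠ 0 := by exact_mod_cast hL.ne'
  calc S.rate ≤ L / (L * ∑ f ∈ Finset.range F, ((t : ℝ≥0∞) ^ f)⁻¹) :=
        ENNReal.div_le_div_left h _
    _ = _ := by
        rw [div_eq_mul_inv, ENNReal.mul_inv (Or.inl hL0) (Or.inl (ENNReal.natCast_ne_top _)),
          ← mul_assoc, ENNReal.mul_inv_cancel hL0 (ENNReal.natCast_ne_top _), one_mul]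

end Scheme

end PIR

namespace PIR

/-! ### The Sun-Jafar scheme -/

theorem otherServer_ne {t : ℕ} (n : Fin t) (h : Fin (t - 1)) : otherServer n h ≠ n := by
  intro he
  have h1 := congrArg Fin.val he
  simp only [otherServer] at h1
  have h2 := n.2
  have h3 := h.2
  rcases lt_or_ge (n.1 + (h.1 + 1)) t with h4 | h4
  · rw [Nat.mod_eq_of_lt h4] at h1
    omega
  · rw [Nat.mod_eq_sub_mod h4, Nat.mod_eq_of_lt (by omega)] at h1
    omega

theorem otherServer_injective {t : ℕ} (n : Fin t) : Function.Injective (otherServer n) := by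
  intro a b h
  have h1 := congrArg Fin.val h
  simp only [otherServer] at h1
  have h2 := n.2
  have h3 := a.2
  have h4 := b.2
  have h5 : (a.1 + 1) % t = (b.1 + 1) % t := Nat.ModEq.add_left_cancel' n.1 h1
  rw [Nat.mod_eq_of_lt (by omega), Nat.mod_eq_of_lt (by omega)] at h5
  exact Fin.ext (by omega)

/-- A server is never asked for the same label of a file twice. -/
theorem sjLabel_injective {F t : ℕ} (θ : Fin F) (n : Fin t) (i : Fin F) :
    Function.Injective (α := {s : Slot F t // i ∈ s.1.1}) (β := Label F t i)
      fun s => sjLabel θ n s.1 ⟨i, s.2⟩ := by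
  rintro ⟨⟨⟨T, hT⟩, a⟩, hi⟩ ⟨⟨⟨T', hT'⟩, a'⟩, hi'⟩ h
  simp only [sjLabel] at h
  -- Interference labels name another server and new bits name `n`, so the mixed cases cannot occur.
  -- Two interference labels determine their set by reinserting θ.
  split_ifs at h with h1 h2 h2
  · simp only [Prod.mk.injEq, Subtype.mk.injEq, Sigma.mk.injEq] at h
    obtain ⟨e1, e2, e3⟩ := h
    obtain rfl : T = T' := by
      rw [← Finset.insert_erase h1.1, Subtype.mk.inj e2, Finset.insert_erase h2.1]
    have e4 := Prod.ext (otherServer_injective n e1) (eq_of_heq e3)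
    have e5 := Fin.cast_injective _ (finProdFinEquiv.symm.injective e4)
    rw [e5]
  · exact absurd (congrArg Prod.fst h) (otherServer_ne n _)
  · exact absurd (congrArg Prod.fst h).symm (otherServer_ne n _)
  · exact (Prod.mk.inj h).2

/-- For each file, both desired indices give an injective list of labels at server `n`, so a
permutation of the labels carries one list to the other. Uniform assignments are invariant under it.
-/
theorem sunJafar_query_map_eq {F t : ℕ} (n : Fin t) (θ θ' : Fin F) :
    ((sunJafar F t).query θ).map (fun q => q n) =
      ((sunJafar F t).query θ').map fun q => q n := by
  have hσ : ∀ i : Fin F, ∃ σ : Equiv.Perm (Label F t i),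
      ∀ s : {s : Slot F t // i ∈ s.1.1}, σ (sjLabel θ n s.1 ⟨i, s.2⟩) = sjLabel θ' n s.1 ⟨i, s.2⟩ :=
    fun i => Equiv.Perm.exists_extending_pair _ _ (sjLabel_injective θ n i)
      (sjLabel_injective θ' n i)
  choose σ hσ using hσ
  let e : ((i : Fin F) → (Label F t i ≃ Fin (t ^ F))) ≃
      ((i : Fin F) → (Label F t i ≃ Fin (t ^ F))) :=
    Equiv.piCongrRight fun i => Equiv.equivCongr (σ i).symm (Equiv.refl _)
  simp only [sunJafar, PMF.map_comp]
  conv_lhs => rw [← uniformOfFintype_map_equiv e, PMF.map_comp]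
  congr 1
  funext g s i
  simp [e, hσ i.1 ⟨s, i.2⟩]

theorem sum_subtype_erase {ι M : Type*} [DecidableEq ι] [AddCommMonoid M] {T : Finset ι} {a : ι}
    (ha : a ∈ T) (f : {i // i ∈ T} → M) :
    ∑ i, f i = f ⟨a, ha⟩ + ∑ i : {i // i ∈ T.erase a}, f ⟨i, Finset.mem_of_mem_erase i.2⟩ := by
  let g : ι → M := fun i => if h : i ∈ T then f ⟨i, h⟩ else 0
  have h1 : ∑ i, f i = ∑ i ∈ T, g i := by
    rw [← Finset.sum_coe_sort T g]
    exact Finset.sum_congr rfl fun (i : {i // i ∈ T}) _ =>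
      (dif_pos (c := i.1 ∈ T) (t := fun h => f ⟨i.1, h⟩) i.2).symm
  have h2 : ∑ i : {i // i ∈ T.erase a}, f ⟨i, Finset.mem_of_mem_erase i.2⟩ =
      ∑ i ∈ T.erase a, g i := by
    rw [← Finset.sum_coe_sort (T.erase a) g]
    exact Finset.sum_congr rfl fun (i : {i // i ∈ T.erase a}) _ =>
      (dif_pos (c := i.1 ∈ T) (t := fun h => f ⟨i.1, h⟩) (Finset.mem_of_mem_erase i.2)).symm
  have h3 : f ⟨a, ha⟩ = g a :=
    (dif_pos (c := a ∈ T) (t := fun h => f ⟨a, h⟩) ha).symm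
  rw [h1, h2, h3, Finset.add_sum_erase T g ha]

/-- The interference in a sum that involves the desired file is one of the downloaded sums. -/
theorem exists_interference {F t : ℕ} (θ : Fin F) (n : Fin t) (s : Slot F t)
    (hθ : θ ∈ s.1.1) (hne : (s.1.1.erase θ).Nonempty) :
    ∃ (m : Fin t) (a : Fin ((t - 1) ^ ((s.1.1.erase θ).card - 1))),
      ∀ i : {i // i ∈ s.1.1.erase θ},
        sjLabel θ n s ⟨i, Finset.mem_of_mem_erase i.2⟩ =
          sjLabel θ m ⟨⟨s.1.1.erase θ, hne⟩, a⟩ i := by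
  obtain ⟨i₀, hi₀⟩ := hne
  let a := finProdFinEquiv.symm (Fin.cast (pow_erase s.1.1 θ i₀ hθ
    (Finset.mem_of_mem_erase hi₀) (Finset.ne_of_mem_erase hi₀)) s.2)
  refine ⟨otherServer n a.1, a.2, fun i => ?_⟩
  have h1 : θ ∈ s.1.1 ∧ i.1 ≠ θ := ⟨hθ, Finset.ne_of_mem_erase i.2⟩
  have h2 : ¬(θ ∈ s.1.1.erase θ ∧ i.1 ≠ θ) := fun h => Finset.notMem_erase _ _ h.1
  rw [sjLabel, dif_pos h1, sjLabel, dif_neg h2]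

/-- By linearity it suffices that a difference of files with vanishing sums vanishes in file θ. Each
label of θ occurs in its own slot, and the interference there is a downloaded sum, hence zero. -/
theorem sunJafar_isCorrect (F t : ℕ) : (sunJafar F t).IsCorrect := by
  rw [Scheme.isCorrect_iff]
  intro θ q hq W W' hW
  obtain ⟨g, -, rfl⟩ := (PMF.mem_support_map_iff _ _ _).1 hq
  have h0 : ∀ (n : Fin t) (s : Slot F t), ∑ i : {i : Fin F // i ∈ s.1.1},
      (W - W') i.1 (g i.1 (sjLabel θ n s i)) = 0 := by
    intro n s
    have := congrFun (hW n) s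
    simp only [sunJafar, Scheme.content] at this
    simp only [Pi.sub_apply, Finset.sum_sub_distrib, this, sub_self]
  funext y
  obtain ⟨⟨n, s, hs⟩, rfl⟩ := (g θ).surjective y
  rw [← sub_eq_zero]
  change (W - W') θ (g θ (n, ⟨s, hs⟩)) = 0
  have h1 := h0 n s
  rw [sum_subtype_erase hs] at h1
  have h2 : sjLabel θ n s ⟨θ, hs⟩ = (n, ⟨s, hs⟩) := dif_neg fun h => h.2 rfl
  simp only [h2] at h1
  rcases (s.1.1.erase θ).eq_empty_or_nonempty with he | hne
  · have : IsEmpty {i // i ∈ s.1.1.erase θ} := ⟨fun i => by simpa [he] using i.2⟩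
    rwa [Finset.univ_eq_empty, Finset.sum_empty, add_zero] at h1
  · obtain ⟨m, a, hma⟩ := exists_interference θ n s hs hne
    simp only [hma] at h1
    rwa [h0 m ⟨⟨s.1.1.erase θ, hne⟩, a⟩, add_zero] at h1

theorem sunJafar_isLinear (F t : ℕ) : (sunJafar F t).IsLinear := by
  intro n q
  constructor
  · intro Z Z'
    funext s
    exact Finset.sum_add_distrib
  · intro c Z
    funext s
    exact (Finset.mul_sum _ _ _).symm

/-- The sets that contain a newly inserted element contribute (c + 1)^{|s|} by the binomial theorem.
-/
theorem sum_powerset_pow_card_sub_one {ι : Type*} [DecidableEq ι] (c : ℕ) (s : Finset ι) :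
    ∑ T ∈ s.powerset, (if T.Nonempty then c ^ (T.card - 1) else 0) =
      ∑ f ∈ Finset.range s.card, (c + 1) ^ f := by
  induction s using Finset.induction_on with
  | empty => simp
  | insert a s ha ih =>
    rw [Finset.sum_powerset_insert ha, ih, Finset.card_insert_of_notMem ha,
      Finset.sum_range_succ, ← Finset.sum_pow_mul_eq_add_pow c 1 s]
    congr 1
    refine Finset.sum_congr rfl fun T hT => ?_
    have haT : a ∉ T := fun h => ha (Finset.mem_powerset.1 hT h)
    rw [if_pos (Finset.insert_nonempty a T), Finset.card_insert_of_notMem haT,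
      Nat.add_sub_cancel, one_pow, mul_one]

theorem mul_card_slot (F : ℕ) {t : ℕ} (ht : 0 < t) :
    t * Fintype.card (Slot F t) = ∑ f ∈ Finset.range F, t ^ (F - f) := by
  have h1 : Fintype.card (Slot F t) = ∑ f ∈ Finset.range F, t ^ f := by
    have h := sum_powerset_pow_card_sub_one (t - 1) (Finset.univ : Finset (Fin F))
    rw [Finset.powerset_univ, Finset.card_univ, Fintype.card_fin, Nat.sub_add_cancel ht,
      ← Finset.sum_filter] at h
    rw [← h, Fintype.card_sigma]
    simp only [Fintype.card_fin]
    exact (Finset.sum_subtype _ (by simp) fun T : Finset (Fin F) =>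
      (t - 1) ^ (T.card - 1)).symm
  rw [h1, Finset.mul_sum, ← Finset.sum_range_reflect]
  refine Finset.sum_congr rfl fun f hf => ?_
  rw [Finset.mem_range] at hf
  rw [← pow_succ']
  congr 1
  omega

end PIR

namespace PIR

namespace TacticalConfiguration

/-! ### Tactical configurations and the protocols obtained from them -/

variable {v k b r : ℕ} (C : TacticalConfiguration v k b r)

theorem mul_blockSize_eq (C : TacticalConfiguration v k b r) : b * k = v * r := by
  have h : ∑ n, (C.block n).card = ∑ j : Fin v, (Finset.univ.filter fun n => j ∈ C.block n).card := by
    simp only [Finset.card_filter]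
    rw [Finset.sum_comm]
    refine Finset.sum_congr rfl fun n _ => ?_
    rw [← Finset.card_filter, Finset.filter_univ_mem]
  simpa [C.card_block, C.card_repetition] using h

/-- A configuration of cyclic intervals. -/
theorem nonempty_of_eq_mul {g : ℕ} (hk : 0 < k) (hkv : k ≤ v) :
    Nonempty (TacticalConfiguration v k (g * v) (g * k)) := by
  have : NeZero v := ⟨by omega⟩
  have hcard : (Finset.univ.filter fun x : Fin v => x.1 < k).card = k := by
    rw [Fin.card_filter_val_lt, min_eq_right hkv]
  -- Block `n` is the cyclic interval of length `k` starting at the second coordinate of `n`; the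
  -- first coordinate only counts the g repetitions.
  let B : Fin (g * v) → Finset (Fin v) := fun n =>
    Finset.univ.filter fun j => (j - (finProdFinEquiv.symm n).2).1 < k
  have hB : ∀ n, (B n).card = k := by
    intro n
    conv_rhs => rw [← hcard]
    refine Finset.card_equiv (Equiv.subRight (finProdFinEquiv.symm n).2) fun j => ?_
    simp [B]
  refine ⟨⟨B, fun n => Finset.card_pos.1 (by rw [hB]; exact hk), hB, fun j => ?_⟩⟩
  -- The point `j` is in a block exactly if its start is j - x with x < k: k starts, each repeated g
  -- times.
  have h1 : (Finset.univ.filter fun n => j ∈ B n).card =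
      ((Finset.univ : Finset (Fin g)) ×ˢ
        (Finset.univ.filter fun x : Fin v => x.1 < k)).card := by
    refine Finset.card_equiv (finProdFinEquiv.symm.trans
      ((Equiv.refl (Fin g)).prodCongr (Equiv.subLeft j))) fun n => ?_
    simp [B]
  rw [h1, Finset.card_product, hcard, Finset.card_univ, Fintype.card_fin]

theorem exists_serverIndex_eq (j : Fin v) (m : Fin r) :
    ∃ (n : Fin b) (i : {j : Fin v // j ∈ C.block n}), i.1 = j ∧ C.serverIndex i = m := by
  have h := (Finset.mem_filter.1 (C.servers j m).2).2
  exact ⟨(C.servers j m).1, ⟨j, h⟩, rfl, (C.servers j).symm_apply_apply m⟩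

theorem card_placement (F M : ℕ) (n : Fin b) (i : Fin F) :
    (C.placement F M n i).card = k * M := by
  have h : C.placement F M n i =
      (C.block n ×ˢ (Finset.univ : Finset (Fin M))).map finProdFinEquiv.toEmbedding := by
    ext x
    simp [placement, subfile, Finset.mem_map_equiv]
  rw [h, Finset.card_map, Finset.card_product, C.card_block, Finset.card_univ, Fintype.card_fin]

variable {F M : ℕ} (P : Scheme r F M)

theorem lift_hasStorage (hb : 0 < b) : (C.lift P).HasStorage ((r : ℝ) / b) := by
  intro n i
  have h1 : ((C.placement F M n i).card : ℝ) = k * M := by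
    rw [C.card_placement, Nat.cast_mul]
  have h2 : (b * k : ℝ) = v * r := by exact_mod_cast C.mul_blockSize_eq
  have h3 : (b : ℝ) ≠ 0 := by exact_mod_cast hb.ne'
  change ((C.placement F M n i).card : ℝ) = _
  rw [h1, Nat.cast_mul, div_mul_eq_mul_div, eq_div_iff h3]
  linear_combination (M : ℝ) * h2

variable {P}

theorem lift_isLinear (hP : P.IsLinear) : (C.lift P).IsLinear := by
  intro n q
  constructor
  · intro Z Z'
    funext a
    exact congrFun ((hP (C.serverIndex a.1) (q a.1)).map_add _ _) a.2
  · intro c Z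
    funext a
    exact congrFun ((hP (C.serverIndex a.1) (q a.1)).map_smul c _) a.2

theorem lift_isCorrect (hP : P.IsCorrect) : (C.lift P).IsCorrect := by
  rw [Scheme.isCorrect_iff] at hP ⊢
  intro θ q hq W W' hW
  obtain ⟨w, hw, rfl⟩ := (PMF.mem_support_map_iff _ _ _).1 hq
  funext x
  obtain ⟨⟨j, y⟩, rfl⟩ := finProdFinEquiv.surjective x
  refine congrFun (hP θ (w j) (mem_support_iid _ hw j)
    (fun i y => W i (finProdFinEquiv (j, y))) (fun i y => W' i (finProdFinEquiv (j, y))) ?_) y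
  intro m
  obtain ⟨n, i, rfl, rfl⟩ := C.exists_serverIndex_eq j m
  funext a
  exact congrFun (hW n) ⟨i, a⟩

/-- Server `n` sees one component of run `j` for each `j` in its block, and nothing of the others.
The runs are independent, so `iid_map_congr` reduces the claim to a single run. -/
theorem lift_query_map_eq
    (hP : ∀ (m : Fin r) (θ θ' : Fin F),
      (P.query θ).map (fun q => q m) = (P.query θ').map fun q => q m)
    (n : Fin b) (θ θ' : Fin F) :
    ((C.lift P).query θ).map (fun q => q n) = ((C.lift P).query θ').map fun q => q n := by
  simp only [lift, PMF.map_comp]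
  let β : Fin v → Type := fun j => (h : j ∈ C.block n) → P.Query (C.serverIndex ⟨j, h⟩)
  let f : (j : Fin v) → ((m : Fin r) → P.Query m) → β j := fun j q h => q (C.serverIndex ⟨j, h⟩)
  have hf : ∀ j, (P.query θ).map (f j) = (P.query θ').map (f j) := by
    intro j
    by_cases h : j ∈ C.block n
    · exact map_eq_of_comp (g := fun (x : P.Query (C.serverIndex ⟨j, h⟩)) (_ : j ∈ C.block n) => x)
        rfl (hP _ θ θ')
    -- Outside the block the observed value is a function on an empty domain, hence constant.
    · have hc : f j = fun _ h' => absurd h' h := funext fun q => funext fun h' => absurd h' h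
      rw [hc, map_fun_const, map_fun_const]
  let g : ((j : Fin v) → β j) → (C.lift P).Query n := fun u j => u j.1 j.2
  exact map_eq_of_comp (g := g) rfl (iid_map_congr f hf)

theorem lift_downloadedBits {c : ℕ} (hP : ∀ m q, Fintype.card (P.Ans m q) = c)
    (q : (n : Fin b) → (C.lift P).Query n) : (C.lift P).downloadedBits q = v * (r * c) := by
  have h : ∀ n, Fintype.card ((C.lift P).Ans n (q n)) = k * c := by
    intro n
    let u : (j : {j // j ∈ C.block n}) → P.Query (C.serverIndex j) := q n
    refine (Fintype.card_sigma (α := fun j => P.Ans (C.serverIndex j) (u j))).trans ?_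
    simp [hP, C.card_block]
  rw [Scheme.downloadedBits, Finset.sum_congr rfl fun n _ => h n]
  rw [Finset.sum_const, Finset.card_univ, Fintype.card_fin, smul_eq_mul, ← mul_assoc,
    C.mul_blockSize_eq, mul_assoc]

variable (F)

theorem protocol_downloadedBits (hr : 0 < r) (q : (n : Fin b) → (C.protocol F).Query n) :
    (C.protocol F).downloadedBits q = v * ∑ f ∈ Finset.range F, r ^ (F - f) := by
  rw [← mul_card_slot F hr]
  exact C.lift_downloadedBits (P := sunJafar F r) (fun _ _ => rfl) q

theorem protocol_isPrivate : (C.protocol F).IsPrivate :=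
  Scheme.isPrivate_of_query_map_eq _ (C.lift_query_map_eq sunJafar_query_map_eq)

theorem protocol_rate (hF : 0 < F) (hv : 0 < v) (hr : 0 < r) :
    (C.protocol F).rate = (∑ f ∈ Finset.range F, ((r : ℝ≥0∞) ^ f)⁻¹)⁻¹ := by
  have : Nonempty (Fin F) := ⟨⟨0, hF⟩⟩
  have hL : ((v * r ^ F : ℕ) : ℝ≥0∞) ≠ 0 := by
    exact_mod_cast (Nat.mul_pos hv (pow_pos hr F)).ne'
  have hr0 : (r : ℝ≥0∞) ≠ 0 := by exact_mod_cast hr.ne'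
  -- The download is the file size times ∑ r^{-f}, which makes the rate independent of `v`.
  have hD : ((v * ∑ f ∈ Finset.range F, r ^ (F - f) : ℕ) : ℝ≥0∞) =
      (v * r ^ F : ℕ) * ∑ f ∈ Finset.range F, ((r : ℝ≥0∞) ^ f)⁻¹ := by
    push_cast
    rw [mul_assoc]
    congr 1
    rw [Finset.mul_sum]
    refine Finset.sum_congr rfl fun f hf => ?_
    rw [Finset.mem_range] at hf
    rw [← div_eq_mul_inv, ENNReal.eq_div_iff (pow_ne_zero _ hr0)
      (ENNReal.pow_ne_top (ENNReal.natCast_ne_top _)), ← pow_add, Nat.add_sub_cancel' hf.le]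
  rw [Scheme.rate, (C.protocol F).downloadCost_eq fun θ q _ => C.protocol_downloadedBits F hr q,
    hD, div_eq_mul_inv, ENNReal.mul_inv (Or.inl hL) (Or.inl (ENNReal.natCast_ne_top _)),
    ← mul_assoc, ENNReal.mul_inv_cancel hL (ENNReal.natCast_ne_top _), one_mul]

end TacticalConfiguration

end PIR

theorem theorem2 (N F t : ℕ) (hF : 1 ≤ F) (ht : 1 ≤ t) (htN : t ≤ N) :
    Nonempty (PIR.TacticalConfiguration (N / Nat.gcd N t) (t / Nat.gcd N t) N t) ∧
    (∀ C : PIR.TacticalConfiguration (N / Nat.gcd N t) (t / Nat.gcd N t) N t,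
      (C.protocol F).HasStorage ((t : ℝ) / N) ∧
      (C.protocol F).IsLinear ∧
      (C.protocol F).IsCorrect ∧
      (C.protocol F).IsPrivate ∧
      (∀ θ : Fin F, ∀ q ∈ ((C.protocol F).query θ).support,
        (C.protocol F).downloadedBits q =
          N / Nat.gcd N t * ∑ f ∈ Finset.range F, t ^ (F - f)) ∧
      (C.protocol F).rate = PIR.capacity ((t : ℝ) / N) F N ∧
      (C.protocol F).rate = (∑ f ∈ Finset.range F, ((t : ENNReal) ^ f)⁻¹)⁻¹) ∧
    N / Nat.gcd N t ≤ N := by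
  have hN : 0 < N := ht.trans htN
  have hg : 0 < Nat.gcd N t := Nat.gcd_pos_of_pos_left t hN
  have hk : 0 < t / Nat.gcd N t := Nat.div_pos (Nat.le_of_dvd ht (Nat.gcd_dvd_right N t)) hg
  have hv : 0 < N / Nat.gcd N t := Nat.div_pos (Nat.le_of_dvd hN (Nat.gcd_dvd_left N t)) hg
  refine ⟨?_, fun C => ?_, Nat.div_le_self _ _⟩
  · have h := PIR.TacticalConfiguration.nonempty_of_eq_mul (g := Nat.gcd N t) hk
      (Nat.div_le_div_right htN)
    rwa [Nat.mul_div_cancel' (Nat.gcd_dvd_left N t),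
      Nat.mul_div_cancel' (Nat.gcd_dvd_right N t)] at h
  · have hst : (C.protocol F).HasStorage ((t : ℝ) / N) := C.lift_hasStorage _ hN
    have hc : (C.protocol F).IsCorrect := C.lift_isCorrect (PIR.sunJafar_isCorrect F t)
    have hp := C.protocol_isPrivate F
    have hr := C.protocol_rate F hF hv ht
    refine ⟨hst, C.lift_isLinear (PIR.sunJafar_isLinear F t), hc, hp,
      fun θ q _ => C.protocol_downloadedBits F ht q, le_antisymm ?_ ?_, hr⟩
    · exact le_sSup ⟨_, Nat.mul_pos hv (pow_pos ht F), C.protocol F, hst, hc, hp, rfl⟩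
    · refine sSup_le ?_
      rintro R ⟨L, hL, S, hst', hc', hp', rfl⟩
      rw [hr]
      exact PIR.Scheme.rate_le hF ht hN hL hst' hc' hp'
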